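/- All graphs are simple. An immersion of a graph $G$ into a graph $H$ is a graph homomorphism that is injective on vertices; it is strong if it is an isomorphism of $G$ onto an induced subgraph of $H$. For a class $\mathcal C$ of graphs, a family $\mathcal F\subseteq\mathcal C$ is strongly universal if every $G\in\mathcal C$ has a strong immersion into some $H\in\mathcal F$, and the strong complexity $\mathrm{Stc}(\mathcal C)$ is the least cardinality of a strongly universal family of $\mathcal C$. For an infinite cardinal $\kappa$ and a graph $B$, let $\mathbf A_\kappa(B)$ be the class of all connected graphs with at most $\kappa$ vertices that contain no ray (one-way infinite path) and into which there is no immersion of $B$. For a graph $K$ and a set $N\subseteq V(K)$, the bouquet $B(K,N)$ is obtained from countably infinitely many pairwise disjoint copies of $K$ by identifying their copies of $N$ (vertex by vertex). A subdivision of a star is a graph obtained from a star $K_{1,\lambda}$, with any finite or infinite number $\lambda\ge 0$ of leaves, by replacing its edges by finite paths that meet only in the centre; in particular, every finite path, including the one-vertex path, is a subdivision of a star. **Theorem.** Let $\kappa$ be an infinite cardinal, let $K$ be a finite graph and let $N\subseteq V(K)$ be such that $K-N$ is connected (in particular non-empty). Suppose that some connected component of $B(K,N)$ is not a subdivision of a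 star. (If $K$ is connected and $N\neq\emptyset$, then $B(K,N)$ is connected, and this says that $B(K,N)$ is not a subdivision of a star.) Then $$\mathrm{Stc}\bigl(\mathbf A_\kappa(B(K,N))\bigr)=\kappa^+ .$$ -/

import Mathlib

universe u v

open scoped Cardinal

namespace RaylessUniversality

/-- A graph, bundled with its vertex type. -/
abbrev GraphObj : Type (u + 1) := Σ V : Type u, SimpleGraph V

/-- A graph is rayless if it contains no one-way infinite path `x₀ x₁ x₂ …`. -/
def Rayless {V : Type u} (G : SimpleGraph V) : Prop :=
  ¬ ∃ x : ℕ → V, Function.Injective x ∧ ∀ n, G.Adj (x n) (x (n + 1))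

/-- The class of `κ`-rayless graphs (connected, rayless, of size at most `κ`) that are `K`-free,
i.e. into which there is no vertex-injective graph morphism from `K`. -/
def raylessFree (κ : Cardinal.{u}) {W : Type v} (K : SimpleGraph W) : Set GraphObj.{u} :=
  {G | G.2.Connected ∧ Rayless G.2 ∧ #G.1 ≤ κ ∧ K.Free G.2}

/-- `F` is a strongly universal family of the class `C`: it consists of members of `C`, and every
member of `C` has a strong immersion into (is isomorphic to an induced subgraph of) one of them. -/
def IsStronglyUniversal (C F : Set GraphObj.{u}) : Prop :=
  F ⊆ C ∧ ∀ G ∈ C, ∃ H ∈ F, Nonempty (G.2 ↪g H.2)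

/-- The strong complexity of a class: the least size of a strongly universal family. -/
noncomputable def stc (C : Set GraphObj.{u}) : Cardinal.{u + 1} :=
  sInf {c | ∃ F : Set GraphObj.{u}, IsStronglyUniversal C F ∧ #F = c}

/-- The bouquet of `K` with stem `N`: countably infinitely many copies of `K`, pairwise disjoint
except that all the copies of `N` are identified. The vertex `Sum.inl a` is `a ∈ N`, and
`Sum.inr (i, c)` is the vertex `c ∉ N` of the `i`-th copy. -/
def bouquet {W : Type v} (K : SimpleGraph W) (N : Set W) :
    SimpleGraph (N ⊕ ℕ × (Nᶜ : Set W)) where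
  Adj
    | Sum.inl a, Sum.inl b => K.Adj a b
    | Sum.inl a, Sum.inr (_, d) => K.Adj a d
    | Sum.inr (_, c), Sum.inl b => K.Adj c b
    | Sum.inr (i, c), Sum.inr (j, d) => i = j ∧ K.Adj c d
  symm := ⟨by
    rintro (a | ⟨i, c⟩) (b | ⟨j, d⟩) h
    · exact SimpleGraph.Adj.symm h
    · exact SimpleGraph.Adj.symm h
    · exact SimpleGraph.Adj.symm h
    · exact ⟨h.1.symm, SimpleGraph.Adj.symm h.2⟩⟩
  loopless := ⟨by
    rintro (a | ⟨i, c⟩) h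
    · exact K.irrefl h
    · exact K.irrefl h.2⟩

/-- The star with centre `none` and one leaf for each `i : ι`, after replacing the edge from the
centre to the `i`-th leaf by a path of length `ℓ i + 1`. The vertices of this path other than the
centre are `(i, 0), …, (i, ℓ i)`, in this order, the last one being the leaf. -/
def subdividedStar {ι : Type v} (ℓ : ι → ℕ) :
    SimpleGraph (Option (Σ i : ι, Fin (ℓ i + 1))) :=
  SimpleGraph.fromRel fun x y =>
    match x, y with
    | none, some q => (q.2 : ℕ) = 0
    | some p, some q => p.1 = q.1 ∧ (q.2 : ℕ) = p.2 + 1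
    | _, none => False

/-- A graph is a subdivision of a star. The star may have any number of leaves, so that
finite paths (one-vertex paths included) and subdivisions of infinite stars are covered. -/
def IsSubdivisionOfStar {V : Type v} (G : SimpleGraph V) : Prop :=
  ∃ (ι : Type v) (ℓ : ι → ℕ), Nonempty (G ≃g subdividedStar ℓ)

end RaylessUniversality

/-! Write `B` for the bouquet. Both bounds use that raylessness is well-foundedness: no path can be
extended forever by fresh vertices (`Rayless.wellFounded`).

Lower bound, by diagonalisation. Suppose at most `κ` members of the class form a strongly universal
family. The pairs (finite set of used vertices, current vertex), taken over all members, form a set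
`P` of at most `κ` states, and extending a path is a well-founded relation on `P`. Let `T` be the
tree of finite descending chains in `P`, with long subdivided edges. It is connected, rayless and of
size at most `κ`. The components of `B` have bounded diameter, so a copy of one in `T` contains at
most one branch vertex and is a subdivided star; hence `T` is `B`-free. An embedding of `T` in a
member gives each branch vertex a state, and states decrease away from the root. Extending a chain
by the state of its own branch vertex gives a longer chain; repeating this from the empty chain
descends forever (`lift_succ_le_mk_of_isStronglyUniversal`).

Upper bound. Removing a vertex `v` from a connected graph leaves components which, labelled by
adjacency to `v`, determine it as a cone. In a rayless graph this decomposition can be iterated as a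
well-founded recursion, each removed vertex contributing one label. To each labelled graph belongs a
type, from a finite set: which small labelled patterns, and which bouquets on parts of `K`, it
contains. The type of a cone depends only on the labels of the apex and on how often each type
occurs among the summands, where all infinite multiplicities count alike (`tp_cone_fst_subset`,
`tp_cone_snd_subset`). Since `K - N` is connected, a copy of it that misses the apex lies in one
summand; infinitely many copies either accumulate in one summand or use infinitely many summands of
one type.

So a summand may be replaced by a larger graph of the same type, and a type that occurs infinitely
often may be represented by `κ` copies of every available graph of that type
(`LFamily.exists_next`). Iterating this through `κ⁺` stages, with at most `κ` graphs in each,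
reaches every graph of the class by a type-preserving strong immersion. The type tells whether `B`
is contained, so the target is again `B`-free. -/

namespace RaylessUniversality

/-! ### Recognising subdivisions of stars -/

/-- In a tree, a vertex has at most one neighbour that is closer to a given root. -/
theorem isTree_pred_unique {V : Type*} {G : SimpleGraph V} (hG : G.IsTree) {c x y z : V}
    (hy : G.Adj y x) (hz : G.Adj z x) (hdy : G.dist c y + 1 = G.dist c x)
    (hdz : G.dist c z + 1 = G.dist c x) : y = z := by
  obtain ⟨p, hp⟩ := hG.1.exists_walk_length_eq_dist c y
  obtain ⟨q, hq⟩ := hG.1.exists_walk_length_eq_dist c z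
  have h1 : (p.concat hy).IsPath :=
    SimpleGraph.Walk.isPath_of_length_eq_dist _ (by rw [SimpleGraph.Walk.length_concat]; omega)
  have h2 : (q.concat hz).IsPath :=
    SimpleGraph.Walk.isPath_of_length_eq_dist _ (by rw [SimpleGraph.Walk.length_concat]; omega)
  have h3 : p.concat hy = q.concat hz :=
    congrArg Subtype.val ((hG.2.subsingleton_path _ _).elim ⟨_, h1⟩ ⟨_, h2⟩)
  have := congrArg SimpleGraph.Walk.penultimate h3
  simpa using this

/-- In a tree, a vertex other than the root has a neighbour that is closer to the root. -/
theorem isTree_exists_pred {V : Type*} {G : SimpleGraph V} (hG : G.Connected) {c x : V}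
    (hx : x ≠ c) : ∃ y, G.Adj y x ∧ G.dist c y + 1 = G.dist c x := by
  obtain ⟨p, hp⟩ := hG.exists_walk_length_eq_dist x c
  cases p with
  | nil => exact absurd rfl hx
  | @cons _ y _ h p =>
    refine ⟨y, h.symm, ?_⟩
    rw [SimpleGraph.Walk.length_cons] at hp
    have h1 := SimpleGraph.dist_le p
    have h2 := hG.dist_triangle (u := x) (v := y) (w := c)
    rw [SimpleGraph.dist_eq_one_iff_adj.2 h] at h2
    rw [SimpleGraph.dist_comm (u := c), SimpleGraph.dist_comm (u := c)]
    omega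

/-- A tree of bounded depth in which every vertex other than the root has degree at most two is a
subdivision of a star. -/
theorem isSubdivisionOfStar_of_isTree {V : Type v} {G : SimpleGraph V} (hG : G.IsTree) (c : V)
    (d : ℕ) (hd : ∀ x, G.dist c x ≤ d)
    (hdeg : ∀ x, x ≠ c → ∀ y₁ y₂ y₃, G.Adj x y₁ → G.Adj x y₂ → G.Adj x y₃ →
      y₁ = y₂ ∨ y₁ = y₃ ∨ y₂ = y₃) : IsSubdivisionOfStar G := by
  classical
  set δ : V → ℕ := G.dist c with hδ
  have succ_unique : ∀ x, x ≠ c → ∀ y z, G.Adj x y → G.Adj x z → δ y = δ x + 1 →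
      δ z = δ x + 1 → y = z := by
    intro x hx y z hy hz hdy hdz
    obtain ⟨w, hw, hdw⟩ := isTree_exists_pred hG.1 hx
    change δ w + 1 = δ x at hdw
    rcases hdeg x hx w y z hw.symm hy hz with h | h | h
    · subst h; omega
    · subst h; omega
    · exact h
  let sc : V → V := fun x => if h : ∃ y, G.Adj x y ∧ δ y = δ x + 1 then h.choose else x
  have sc_le : ∀ x, δ (sc x) ≤ δ x + 1 := by
    intro x
    by_cases h : ∃ y, G.Adj x y ∧ δ y = δ x + 1
    · simp only [sc, dif_pos h]; exact h.choose_spec.2.le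
    · simp only [sc, dif_neg h]; omega
  have sc_adj : ∀ x, δ (sc x) = δ x + 1 → G.Adj x (sc x) := by
    intro x hx
    by_cases h : ∃ y, G.Adj x y ∧ δ y = δ x + 1
    · simp only [sc, dif_pos h]; exact h.choose_spec.1
    · simp only [sc, dif_neg h] at hx; omega
  have sc_eq : ∀ x, x ≠ c → ∀ y, G.Adj x y → δ y = δ x + 1 → sc x = y := by
    intro x hx y hy hdy
    have h : ∃ y, G.Adj x y ∧ δ y = δ x + 1 := ⟨y, hy, hdy⟩
    simp only [sc, dif_pos h]
    exact succ_unique x hx _ _ h.choose_spec.1 hy h.choose_spec.2 hdy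
  have δ_adj : ∀ i, G.Adj c i → δ i = 1 := fun i hi => SimpleGraph.dist_eq_one_iff_adj.2 hi
  let ι : Type v := {y // G.Adj c y}
  have it_le : ∀ (i : ι) n, δ (sc^[n] i.1) ≤ n + 1 := by
    intro i n
    induction n with
    | zero => exact (δ_adj i.1 i.2).le
    | succ n ih =>
      rw [Function.iterate_succ_apply']
      exact (sc_le _).trans (by omega)
  have it_down : ∀ (i : ι) n, δ (sc^[n + 1] i.1) = n + 2 → δ (sc^[n] i.1) = n + 1 := by
    intro i n h
    rw [Function.iterate_succ_apply'] at h
    have := sc_le (sc^[n] i.1)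
    have := it_le i n
    omega
  let ℓ : ι → ℕ := fun i => Nat.findGreatest (fun n => δ (sc^[n] i.1) = n + 1) d
  have ℓ_spec : ∀ (i : ι) n, n ≤ ℓ i ↔ δ (sc^[n] i.1) = n + 1 := by
    intro i n
    constructor
    · intro h
      have h0 : δ (sc^[ℓ i] i.1) = ℓ i + 1 :=
        Nat.findGreatest_spec (P := fun n => δ (sc^[n] i.1) = n + 1) (m := 0) (Nat.zero_le d)
          (δ_adj i.1 i.2)
      exact Nat.decreasingInduction (motive := fun m _ => δ (sc^[m] i.1) = m + 1)
        (fun k _ hk => it_down i k hk) h0 h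
    · intro h
      refine Nat.le_findGreatest ?_ h
      have := hd (sc^[n] i.1)
      change δ _ ≤ d at this
      omega
  have ne_c : ∀ x, 0 < δ x → x ≠ c := by
    rintro x hx rfl
    simp [hδ] at hx
  have it_inj : ∀ (i j : ι) n, δ (sc^[n] i.1) = n + 1 → δ (sc^[n] j.1) = n + 1 →
      sc^[n] i.1 = sc^[n] j.1 → i = j := by
    intro i j n
    induction n with
    | zero => intro _ _ h; exact Subtype.ext h
    | succ n ih =>
      intro hi hj h
      have hi' := it_down i n hi
      have hj' := it_down j n hj
      refine ih hi' hj' ?_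
      rw [Function.iterate_succ_apply'] at hi hj
      rw [Function.iterate_succ_apply', Function.iterate_succ_apply'] at h
      have a1 := sc_adj (sc^[n] i.1) (by omega)
      have a2 := sc_adj (sc^[n] j.1) (by omega)
      rw [← h] at a2
      exact isTree_pred_unique hG (c := c) a1 a2 (by change δ _ + 1 = δ _; omega)
        (by change δ _ + 1 = δ _; omega)
  let Φ : Option (Σ i : ι, Fin (ℓ i + 1)) → V := fun x => x.elim c (fun p => sc^[p.2] p.1.1)
  have Φδ : ∀ p : Σ i : ι, Fin (ℓ i + 1), δ (Φ (some p)) = p.2 + 1 := fun p =>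
    (ℓ_spec p.1 p.2).1 (by have := p.2.2; omega)
  have Φδ0 : δ (Φ none) = 0 := by simp [Φ, hδ]
  have Φinj : Function.Injective Φ := by
    rintro (_ | ⟨i, n, hn⟩) (_ | ⟨j, m, hm⟩) h
    · rfl
    · have := Φδ ⟨j, m, hm⟩; rw [← h, Φδ0] at this; simp at this
    · have := Φδ ⟨i, n, hn⟩; rw [h, Φδ0] at this; simp at this
    · have h1 := Φδ ⟨i, n, hn⟩
      have h2 := Φδ ⟨j, m, hm⟩
      have h3 : n = m := by rw [h, h2] at h1; simp at h1; omega
      subst h3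
      obtain rfl : i = j := it_inj i j n h1 h2 h
      rfl
  have Φsurj' : ∀ n x, δ x = n + 1 → ∃ p : Σ i : ι, Fin (ℓ i + 1), Φ (some p) = x := by
    intro n
    induction n with
    | zero =>
      intro x hx
      have : G.Adj c x := SimpleGraph.dist_eq_one_iff_adj.1 hx
      exact ⟨⟨⟨x, this⟩, 0, by omega⟩, rfl⟩
    | succ n ih =>
      intro x hx
      obtain ⟨y, hy, hdy⟩ := isTree_exists_pred hG.1 (ne_c x (by omega))
      change δ y + 1 = δ x at hdy
      obtain ⟨⟨i, m, hm⟩, hp⟩ := ih y (by omega)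
      have h1 := Φδ ⟨i, m, hm⟩
      rw [hp] at h1
      have h2 : sc y = x := sc_eq y (ne_c y (by omega)) x hy hdy.symm
      have h3 : sc^[m + 1] i.1 = x := by
        rw [Function.iterate_succ_apply', ← h2, ← hp]
        rfl
      simp only at h1
      refine ⟨⟨i, m + 1, ?_⟩, h3⟩
      rw [Nat.lt_succ_iff, ℓ_spec, h3]
      omega
  have Φsurj : Function.Surjective Φ := by
    intro x
    rcases Nat.eq_zero_or_pos (δ x) with h | h
    · exact ⟨none, (hG.1.dist_eq_zero_iff.1 h)⟩
    · obtain ⟨n, hn⟩ := Nat.exists_eq_add_of_le' h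
      obtain ⟨p, hp⟩ := Φsurj' n x hn
      exact ⟨_, hp⟩
  let rel : Option (Σ i : ι, Fin (ℓ i + 1)) → Option (Σ i : ι, Fin (ℓ i + 1)) → Prop :=
    fun x y => match x, y with
    | none, some q => (q.2 : ℕ) = 0
    | some p, some q => p.1 = q.1 ∧ (q.2 : ℕ) = p.2 + 1
    | _, none => False
  have rel_adj : ∀ x y, rel x y → G.Adj (Φ x) (Φ y) := by
    rintro (_ | ⟨i, n, hn⟩) (_ | ⟨j, m, hm⟩) h
    · exact h.elim
    · change m = 0 at h
      subst h
      exact j.2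
    · exact h.elim
    · obtain ⟨h1, h2⟩ := h
      change i = j at h1
      change m = n + 1 at h2
      subst h1 h2
      have h1 := Φδ ⟨i, n, hn⟩
      have h2 := Φδ ⟨i, n + 1, hm⟩
      simp only [Φ, Option.elim] at h1 h2 ⊢
      rw [Function.iterate_succ_apply'] at h2 ⊢
      exact sc_adj _ (by omega)
  have adj_rel : ∀ x y, G.Adj (Φ x) (Φ y) → δ (Φ y) = δ (Φ x) + 1 → rel x y := by
    rintro (_ | ⟨i, n, hn⟩) (_ | ⟨j, m, hm⟩) h hδ'
    · simp at h
    · rw [Φδ, Φδ0] at hδ'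
      change m = 0
      simpa using hδ'
    · rw [Φδ0] at hδ'; omega
    · have h1 := Φδ ⟨i, n, hn⟩
      have h2 := Φδ ⟨j, m, hm⟩
      have h3 := sc_eq _ (ne_c _ (by omega)) _ h hδ'
      simp only at h1 h2
      have h4 : m = n + 1 := by omega
      subst h4
      refine ⟨it_inj i j (n + 1) ?_ h2 ?_, rfl⟩
      · rw [Function.iterate_succ_apply']
        change δ (sc (Φ (some ⟨i, n, hn⟩))) = _
        rw [h3]; exact h2
      · rw [Function.iterate_succ_apply']
        exact h3
  have Φadj : ∀ x y, G.Adj (Φ x) (Φ y) ↔ (subdividedStar ℓ).Adj x y := by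
    intro x y
    change _ ↔ (SimpleGraph.fromRel rel).Adj x y
    rw [SimpleGraph.fromRel_adj]
    constructor
    · intro h
      refine ⟨fun e => h.ne (congrArg Φ e), ?_⟩
      rcases hG.dist_eq_dist_add_one_of_adj c h with h' | h'
      · exact Or.inr (adj_rel _ _ h.symm h')
      · exact Or.inl (adj_rel _ _ h h')
    · rintro ⟨_, h | h⟩
      · exact rel_adj _ _ h
      · exact (rel_adj _ _ h).symm
  refine ⟨ι, ℓ, ⟨RelIso.symm ⟨Equiv.ofBijective Φ ⟨Φinj, Φsurj⟩, ?_⟩⟩⟩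
  intro x y
  exact Φadj x y


/-! ### Raylessness as well-foundedness -/

/-- In a rayless graph one cannot walk forever inside a shrinking set of fresh vertices. -/
theorem Rayless.wellFounded {V : Type u} {G : SimpleGraph V} (h : Rayless G) :
    WellFounded (fun p q : Set V × V => p.2 ∈ p.1 ∧ p.1 ⊆ q.1 \ {q.2} ∧ G.Adj q.2 p.2) := by
  rw [wellFounded_iff_isEmpty_descending_chain]
  refine ⟨fun ⟨f, hf⟩ => h ⟨fun n => (f (n + 1)).2, ?_, fun n => (hf (n + 1)).2.2⟩⟩
  have key : ∀ n k, (f (n + 1 + k)).1 ⊆ (f n).1 \ {(f n).2} := by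
    intro n k
    induction k with
    | zero => exact (hf n).2.1
    | succ k ih => exact ((hf (n + 1 + k)).2.1.trans Set.sdiff_subset).trans ih
  have key2 : ∀ n m, n < m → (f (n + 1)).2 ≠ (f (m + 1)).2 := by
    intro n m hnm e
    have h1 := key (n + 1) (m - n - 1)
    have h2 : n + 1 + 1 + (m - n - 1) = m + 1 := by omega
    rw [h2] at h1
    exact (h1 (hf m).1).2 e.symm
  intro n m e
  by_contra hne
  rcases lt_or_gt_of_ne hne with h' | h'
  · exact key2 _ _ h' e
  · exact key2 _ _ h' e.symm

/-! ### Graphs of parent functions -/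

/-- The graph in which every vertex is joined to its parent. -/
def parentGraph {T : Type*} (par : T → T) : SimpleGraph T :=
  SimpleGraph.fromRel fun x y => par x = y

theorem parentGraph_adj {T : Type*} {par : T → T} {x y : T} :
    (parentGraph par).Adj x y ↔ x ≠ y ∧ (par x = y ∨ par y = x) :=
  SimpleGraph.fromRel_adj _ _ _

theorem parentGraph_adj_par {T : Type*} {par : T → T} {x : T} (h : par x ≠ x) :
    (parentGraph par).Adj x (par x) :=
  parentGraph_adj.2 ⟨h.symm, Or.inl rfl⟩

/-- Every edge from `x` to `par x` is a bridge: all other edges preserve the property of being a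
descendant of `x`, which `par x` lacks because its depth is smaller. -/
theorem parentGraph_isAcyclic {T : Type*} {par : T → T} (dep : T → ℕ)
    (hdep : ∀ x, par x ≠ x → dep (par x) < dep x) : (parentGraph par).IsAcyclic := by
  have hle : ∀ n x, dep (par^[n] x) ≤ dep x := by
    intro n x
    induction n with
    | zero => exact le_rfl
    | succ n ih =>
      rw [Function.iterate_succ_apply']
      by_cases h : par (par^[n] x) = par^[n] x
      · rw [h]; exact ih
      · exact (hdep _ h).le.trans ih
  have main : ∀ x, par x ≠ x → (parentGraph par).IsBridge s(x, par x) := by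
    intro x hx
    rw [SimpleGraph.isBridge_iff]
    rintro ⟨p⟩
    have step : ∀ a b, ((parentGraph par).deleteEdges {s(x, par x)}).Adj a b → par a = b →
        ((∃ n, par^[n] a = x) ↔ ∃ n, par^[n] b = x) := by
      rintro a _ hab rfl
      rw [SimpleGraph.deleteEdges_adj] at hab
      have hax : a ≠ x := by rintro rfl; exact hab.2 rfl
      constructor
      · rintro ⟨n, hn⟩
        cases n with
        | zero => exact absurd hn hax
        | succ n => exact ⟨n, hn⟩
      · rintro ⟨n, hn⟩
        exact ⟨n + 1, hn⟩
    have all : ∀ {a b} (_ : ((parentGraph par).deleteEdges {s(x, par x)}).Walk a b),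
        (∃ n, par^[n] a = x) → ∃ n, par^[n] b = x := by
      intro a b q
      induction q with
      | nil => exact id
      | cons h q ih =>
        intro ha
        apply ih
        rcases (parentGraph_adj.1 (SimpleGraph.deleteEdges_adj.1 h).1).2 with h' | h'
        · exact (step _ _ h h').1 ha
        · exact (step _ _ h.symm h').2 ha
    obtain ⟨n, hn⟩ := all p ⟨0, rfl⟩
    have := hle n (par x)
    rw [hn] at this
    exact absurd (hdep x hx) (by omega)
  rw [SimpleGraph.isAcyclic_iff_forall_adj_isBridge]
  intro x y h
  obtain ⟨hne, rfl | rfl⟩ := parentGraph_adj.1 h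
  · exact main x hne.symm
  · rw [Sym2.eq_swap]; exact main y hne

theorem parentGraph_connected {T : Type*} {par : T → T} (dep : T → ℕ)
    (hdep : ∀ x, par x ≠ x → dep (par x) < dep x) (root : T)
    (hroot : ∀ x, par x = x → x = root) : (parentGraph par).Connected := by
  have : ∀ n x, dep x ≤ n → (parentGraph par).Reachable x root := by
    intro n
    induction n with
    | zero =>
      intro x hx
      by_cases h : par x = x
      · rw [hroot x h]
      · have := hdep x h; omega
    | succ n ih =>
      intro x hx
      by_cases h : par x = x
      · rw [hroot x h]
      · have := hdep x h
        exact (parentGraph_adj_par h).reachable.trans (ih _ (by omega))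
  exact (SimpleGraph.connected_iff _).2
    ⟨fun x y => (this _ x le_rfl).trans (this _ y le_rfl).symm, ⟨root⟩⟩

/-- A ray cannot climb forever, as the depth drops at each step to a parent. After one step to a
child, injectivity forbids turning back, so the tail is an infinite sequence of successive children.
-/
theorem parentGraph_rayless {T : Type u} {par : T → T} (dep : T → ℕ)
    (hdep : ∀ x, par x ≠ x → dep (par x) < dep x)
    (hwf : WellFounded fun y x : T => par y = x ∧ y ≠ x) : Rayless (parentGraph par) := by
  rintro ⟨x, hinj, hadj⟩
  have hne : ∀ n, x n ≠ x (n + 1) := fun n h => by simpa using hinj h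
  have down : ∀ n, par (x (n + 1)) = x n → par (x (n + 2)) = x (n + 1) := by
    intro n h
    rcases (parentGraph_adj.1 (hadj (n + 1))).2 with h' | h'
    · rw [h] at h'
      have := hinj h'
      omega
    · exact h'
  have ex : ∃ n, par (x (n + 1)) = x n := by
    by_contra hcon
    push Not at hcon
    have up : ∀ n, dep (x (n + 1)) < dep (x n) := by
      intro n
      have h1 : par (x n) = x (n + 1) :=
        (parentGraph_adj.1 (hadj n)).2.resolve_right (hcon n)
      rw [← h1]
      exact hdep _ (by rw [h1]; exact (hne n).symm)
    have : ∀ n, dep (x n) + n ≤ dep (x 0) := by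
      intro n
      induction n with
      | zero => simp
      | succ n ih => have := up n; omega
    have := this (dep (x 0) + 1)
    omega
  obtain ⟨n, hn⟩ := ex
  have all : ∀ k, par (x (n + k + 1)) = x (n + k) := by
    intro k
    induction k with
    | zero => exact hn
    | succ k ih => exact down (n + k) ih
  exact (wellFounded_iff_isEmpty_descending_chain.1 hwf).false
    ⟨fun k => x (n + k), fun k => ⟨all k, (hne (n + k)).symm⟩⟩

/-! ### Path states of an embedded rooted tree -/

/-- For an injective map `h` on a rooted tree, the images of the proper ancestors of `x`. -/
noncomputable def ancestorImages {T : Type*} {V : Type u} (par : T → T) (dep : T → ℕ)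
    (h : T → V) (x : T) : Finset V :=
  open Classical in (Finset.range (dep x)).image fun j => h (par^[j + 1] x)

/-- One step of a path in `G`: the current vertex joins the finite set of used vertices and is
replaced by an unused neighbour. -/
def PathStep {V : Type u} (G : SimpleGraph V) (p q : Finset V × V) : Prop :=
  p.2 ∉ p.1 ∧ q.1 ⊆ p.1 ∧ q.2 ∈ p.1 ∧ G.Adj q.2 p.2

theorem Rayless.wellFounded_pathStep {V : Type u} {G : SimpleGraph V} (h : Rayless G) :
    WellFounded (PathStep G) := by
  refine Subrelation.wf (r := InvImage _ fun p : Finset V × V => ((p.1 : Set V)ᶜ, p.2)) ?_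
    (InvImage.wf _ h.wellFounded)
  rintro ⟨F', x'⟩ ⟨F, x⟩ ⟨h1, h2, h3, h4⟩
  refine ⟨by simpa using h1, ?_, h4⟩
  intro y hy
  simp only [Set.mem_compl_iff, Finset.mem_coe, Set.mem_sdiff, Set.mem_singleton_iff] at hy ⊢
  exact ⟨fun hyF => hy (h2 hyF), by rintro rfl; exact hy h3⟩

/-- The image of the branch from the root to `x` is a path in `G`. The new vertex is fresh because
`f` is injective and no proper ancestor of `x` has the depth of `x`. -/
theorem pathStep_ancestorImages {T : Type*} {V : Type u} {par : T → T} {dep : T → ℕ}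
    (hdep : ∀ x, par x ≠ x → dep (par x) + 1 = dep x) {G : SimpleGraph V}
    (f : parentGraph par →g G) (hf : Function.Injective f) {x : T} (hx : par x ≠ x) :
    PathStep G (ancestorImages par dep f x, f x)
      (ancestorImages par dep f (par x), f (par x)) := by
  classical
  have hle : ∀ n y, dep (par^[n] y) ≤ dep y := by
    intro n y
    induction n with
    | zero => exact le_rfl
    | succ n ih =>
      rw [Function.iterate_succ_apply']
      by_cases h : par (par^[n] y) = par^[n] y
      · rw [h]; exact ih
      · have := hdep _ h; omega
  have hdx := hdep x hx
  refine ⟨?_, ?_, ?_, f.map_adj (parentGraph_adj_par hx).symm⟩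
  · simp only [ancestorImages, Finset.mem_image, Finset.mem_range, not_exists, not_and]
    intro j _ e
    have h1 := hf e
    have h2 := hle j (par x)
    rw [Function.iterate_succ_apply] at h1
    rw [h1] at h2
    omega
  · intro y hy
    simp only [ancestorImages, Finset.mem_image, Finset.mem_range] at hy ⊢
    obtain ⟨j, hj, rfl⟩ := hy
    exact ⟨j + 1, by omega, rfl⟩
  · simp only [ancestorImages, Finset.mem_image, Finset.mem_range]
    exact ⟨0, by omega, rfl⟩


/-! ### Trees of descending chains with subdivided edges -/

/-- The parent function of the tree of finite `r`-descending chains (the largest element is the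
last one in the list), whose edges have been subdivided `d` times. The branch vertex of a chain `l`
is `(l, d)`. -/
def chainPar {P : Type u} (r : P → P → Prop) (d : ℕ) :
    {l : List P // l.IsChain r} × Fin (d + 1) → {l : List P // l.IsChain r} × Fin (d + 1)
  | (l, ⟨s + 1, h⟩) => (l, ⟨s, by omega⟩)
  | (⟨_ :: l, h⟩, ⟨0, _⟩) => (⟨l, h.tail⟩, Fin.last d)
  | (⟨[], h⟩, ⟨0, h'⟩) => (⟨[], h⟩, ⟨0, h'⟩)

/-- The depth of a vertex of the tree of descending chains. -/
def chainDep {P : Type u} (r : P → P → Prop) (d : ℕ)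
    (x : {l : List P // l.IsChain r} × Fin (d + 1)) : ℕ :=
  (d + 1) * x.1.1.length + x.2

theorem chainDep_par {P : Type u} (r : P → P → Prop) (d : ℕ) :
    ∀ x, chainPar r d x ≠ x → chainDep r d (chainPar r d x) + 1 = chainDep r d x
  | (l, ⟨s + 1, h⟩), _ => by simp [chainPar, chainDep]; ring
  | (⟨a :: l, h⟩, ⟨0, _⟩), _ => by simp [chainPar, chainDep]; ring
  | (⟨[], h⟩, ⟨0, h'⟩), hx => by simp [chainPar] at hx

theorem chainDep_par_lt {P : Type u} (r : P → P → Prop) (d : ℕ) (x)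
    (hx : chainPar r d x ≠ x) : chainDep r d (chainPar r d x) < chainDep r d x := by
  have := chainDep_par r d x hx
  omega

theorem chainPar_cons_ne {P : Type u} {r : P → P → Prop} {d : ℕ} {a : P} {l : List P}
    (h : (a :: l).IsChain r) (h' : 0 < d + 1) :
    chainPar r d (⟨a :: l, h⟩, ⟨0, h'⟩) ≠ (⟨a :: l, h⟩, ⟨0, h'⟩) := by
  intro e
  have : l = a :: l := congrArg (fun x => x.1.1) e
  simpa using congrArg List.length this

theorem chainPar_eq_self {P : Type u} (r : P → P → Prop) (d : ℕ) :
    ∀ x, chainPar r d x = x → x = (⟨[], List.IsChain.nil⟩, ⟨0, by omega⟩)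
  | (l, ⟨s + 1, h⟩), hx => by simp [chainPar] at hx
  | (⟨a :: l, h⟩, ⟨0, h'⟩), hx => absurd hx (chainPar_cons_ne h h')
  | (⟨[], h⟩, ⟨0, h'⟩), _ => rfl

/-- Along successive extensions the heads descend in `r`, so induction on the head works whatever
the tail is. -/
theorem wellFounded_list_extension {P : Type u} {r : P → P → Prop} (hr : WellFounded r) :
    WellFounded fun l' l : List P => l'.IsChain r ∧ ∃ a, l' = a :: l := by
  have h1 : ∀ a l, Acc (fun l' l : List P => l'.IsChain r ∧ ∃ a, l' = a :: l) (a :: l) := by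
    intro a
    induction a using hr.induction with
    | _ a ih =>
      intro l
      refine ⟨_, ?_⟩
      rintro _ ⟨hc, b, rfl⟩
      exact ih b (List.isChain_cons_cons.1 hc).1 _
  refine ⟨fun l => ?_⟩
  refine ⟨_, ?_⟩
  rintro _ ⟨_, b, rfl⟩
  exact h1 b l

/-- Moving to a child either lengthens the chain or brings the subdivision index closer to `d`; a
lexicographic order combines the two. -/
theorem chainPar_wellFounded {P : Type u} {r : P → P → Prop} (hr : WellFounded r) (d : ℕ) :
    WellFounded fun y x => chainPar r d y = x ∧ y ≠ x := by
  refine Subrelation.wf (r := InvImage (Prod.Lex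
    (fun l' l : List P => l'.IsChain r ∧ ∃ a, l' = a :: l) (fun a b : ℕ => a < b))
    fun x : {l : List P // l.IsChain r} × Fin (d + 1) => (x.1.1, d - (x.2 : ℕ))) ?_
    (InvImage.wf _ (WellFounded.prod_lex (wellFounded_list_extension hr) wellFounded_lt))
  rintro y _ ⟨rfl, hne⟩
  match y, hne with
  | (l, ⟨s + 1, h⟩), _ =>
    exact Prod.Lex.right _ (show d - (s + 1) < d - s by omega)
  | (⟨a :: l, h⟩, ⟨0, _⟩), _ =>
    exact Prod.Lex.left _ _ ⟨h, a, rfl⟩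
  | (⟨[], h⟩, ⟨0, h'⟩), hx => simp [chainPar] at hx

/-- Two different branch vertices of the tree of descending chains are far apart. -/
theorem chainTree_lt_length {P : Type u} {r : P → P → Prop} {d : ℕ}
    {l₀ l₁ : {l : List P // l.IsChain r}} (hne : l₀ ≠ l₁)
    (p : (parentGraph (chainPar r d)).Walk (l₀, Fin.last d) (l₁, Fin.last d)) :
    d < p.length := by
  classical
  -- The distance to the branch vertex of `l₀`, truncated at `d + 1`. It changes by at most one
  -- along an edge.
  let g : {l : List P // l.IsChain r} × Fin (d + 1) → ℕ := fun x =>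
    if x.1 = l₀ then d - x.2 else if ∃ a, x.1.1 = a :: l₀.1 then x.2 + 1 else d + 1
  have cons_ne : ∀ (a : P) (l : List P), a :: l ≠ l := fun a l h => by
    simpa using congrArg List.length h
  have hg : ∀ x, g x ≤ g (chainPar r d x) + 1 ∧ g (chainPar r d x) ≤ g x + 1
    | (l, ⟨s + 1, h⟩) => by
      simp only [g, chainPar]
      split_ifs <;> omega
    | (⟨a :: l, h⟩, ⟨0, _⟩) => by
      simp only [g, chainPar, Fin.val_last]
      by_cases h1 : l = l₀.1
      · have h2 : (⟨a :: l, h⟩ : {l : List P // l.IsChain r}) ≠ l₀ := by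
          rintro rfl; exact cons_ne _ _ h1.symm
        have h3 : (⟨l, h.tail⟩ : {l : List P // l.IsChain r}) = l₀ := Subtype.ext h1
        rw [if_neg h2, if_pos h3, if_pos ⟨a, by rw [h1]⟩]
        omega
      · have h3 : (⟨l, h.tail⟩ : {l : List P // l.IsChain r}) ≠ l₀ := by
          rintro rfl; exact h1 rfl
        rw [if_neg h3]
        have h4 : ¬ ∃ b, a :: l = b :: l₀.1 := by
          rintro ⟨b, hb⟩; exact h1 (List.cons.inj hb).2
        rw [if_neg h4]
        split_ifs <;> omega
    | (⟨[], h⟩, ⟨0, h'⟩) => by simp [chainPar]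
  have hwalk : ∀ {x y} (q : (parentGraph (chainPar r d)).Walk x y), g y ≤ g x + q.length := by
    intro x y q
    induction q with
    | nil => simp
    | @cons x z y hxz q ih =>
      rw [SimpleGraph.Walk.length_cons]
      rcases (parentGraph_adj.1 hxz).2 with h | h
      · have := hg x; rw [h] at this; omega
      · have := hg z; rw [h] at this; omega
  have h1 := hwalk p
  have h2 : g (l₀, Fin.last d) = 0 := by simp [g]
  have h3 : g (l₁, Fin.last d) = d + 1 := by
    simp only [g, Fin.val_last]
    rw [if_neg (fun h => hne h.symm)]
    split_ifs <;> rfl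
  omega

/-- Away from the branch vertices the degree is at most two: below a vertex with `s < d` there is
only the next subdivision vertex. -/
theorem chainTree_neighbor {P : Type u} {r : P → P → Prop} {d : ℕ}
    {l : {l : List P // l.IsChain r}} {s : ℕ} (hs : s < d) :
    ∀ y, (parentGraph (chainPar r d)).Adj (l, ⟨s, by omega⟩) y →
      y = chainPar r d (l, ⟨s, by omega⟩) ∨ y = (l, ⟨s + 1, by omega⟩) := by
  intro y hy
  rcases (parentGraph_adj.1 hy).2 with h | h
  · exact Or.inl h.symm
  · right
    match y, h, hy with
    | (l', ⟨t + 1, _⟩), h, _ =>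
      simp only [chainPar, Prod.mk.injEq, Fin.mk.injEq] at h
      obtain ⟨rfl, rfl⟩ := h
      rfl
    | (⟨a :: l', _⟩, ⟨0, _⟩), h, _ =>
      simp only [chainPar, Prod.mk.injEq, Fin.ext_iff, Fin.val_last] at h
      omega
    | (⟨[], _⟩, ⟨0, _⟩), h, hy =>
      exact absurd h.symm hy.ne

/-- A graph whose components have small diameter and that embeds in a tree of descending chains
with long edges has only subdivided stars as components. -/
theorem isSubdivisionOfStar_of_copy_chainTree {P : Type u} {r : P → P → Prop} {d : ℕ}
    {V : Type v} {B : SimpleGraph V}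
    (hB : ∀ x y, B.Reachable x y → ∃ p : B.Walk x y, p.length ≤ d)
    (f : SimpleGraph.Copy B (parentGraph (chainPar r d))) (D : B.ConnectedComponent) :
    IsSubdivisionOfStar D.toSimpleGraph := by
  classical
  have hconn := D.connected_toSimpleGraph
  let g : D.toSimpleGraph →g parentGraph (chainPar r d) := f.toHom.comp D.toSimpleGraph_hom
  have hg : Function.Injective g := fun x y h => Subtype.ext (f.injective h)
  have htree : D.toSimpleGraph.IsTree :=
    ⟨hconn, (parentGraph_isAcyclic _ (chainDep_par_lt r d)).comap g hg⟩
  have hwalk : ∀ x y : D, ∃ p : D.toSimpleGraph.Walk x y, p.length ≤ d := by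
    rintro ⟨x, hx⟩ ⟨y, hy⟩
    obtain ⟨p, hp⟩ := hB x y (D.reachable_of_mem_supp hx hy)
    have hsup : ∀ z ∈ p.support, z ∈ D.supp := fun z hz => by
      change B.connectedComponentMk x = D at hx
      rw [SimpleGraph.ConnectedComponent.mem_supp_iff, ← hx]
      exact SimpleGraph.ConnectedComponent.sound ⟨(p.takeUntil z hz).reverse⟩
    refine ⟨p.induce D.supp hsup, ?_⟩
    have h2 := congrArg SimpleGraph.Walk.length (SimpleGraph.Walk.map_induce p hsup)
    rw [SimpleGraph.Walk.length_map] at h2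
    exact h2.le.trans hp
  -- The centre is the only vertex at a branch vertex, as two branch vertices are more than `d`
  -- apart. If there is none, any vertex will do.
  obtain ⟨c, hc⟩ : ∃ c : D, ∀ x, x ≠ c → (g x).2 ≠ Fin.last d := by
    by_cases h : ∃ c : D, (g c).2 = Fin.last d
    · obtain ⟨c, hc⟩ := h
      refine ⟨c, fun x hx hx' => ?_⟩
      obtain ⟨p, hp⟩ := hwalk c x
      have e1 : g c = ((g c).1, Fin.last d) := Prod.ext rfl hc
      have e2 : g x = ((g x).1, Fin.last d) := Prod.ext rfl hx'
      have hne : (g c).1 ≠ (g x).1 := by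
        intro h
        apply hx
        apply hg
        rw [e1, e2, h]
      have := chainTree_lt_length hne ((p.map g).copy e1 e2)
      rw [SimpleGraph.Walk.length_copy, SimpleGraph.Walk.length_map] at this
      omega
    · push Not at h
      obtain ⟨c⟩ := hconn.nonempty
      exact ⟨c, fun x _ => h x⟩
  refine isSubdivisionOfStar_of_isTree htree c d (fun x => ?_) ?_
  · obtain ⟨p, hp⟩ := hwalk c x
    exact (SimpleGraph.dist_le p).trans hp
  · intro x hx y₁ y₂ y₃ h₁ h₂ h₃
    obtain ⟨l, s, hs⟩ : ∃ l s, ∃ hs : s < d, g x = (l, ⟨s, by omega⟩) := by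
      refine ⟨(g x).1, (g x).2, ?_, rfl⟩
      have h1 := hc x hx
      have h2 := (g x).2.2
      by_contra hcon
      exact h1 (Fin.ext (by rw [Fin.val_last]; omega))
    obtain ⟨hs, hgx⟩ := hs
    have nb : ∀ y, D.toSimpleGraph.Adj x y → g y = chainPar r d (l, ⟨s, by omega⟩) ∨
        g y = (l, ⟨s + 1, by omega⟩) := by
      intro y hy
      have := g.map_adj hy
      rw [hgx] at this
      exact chainTree_neighbor hs _ this
    rcases nb _ h₁ with e₁ | e₁ <;> rcases nb _ h₂ with e₂ | e₂ <;>
      rcases nb _ h₃ with e₃ | e₃ <;>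
      first
      | exact Or.inl (hg (e₁.trans e₂.symm))
      | exact Or.inr (Or.inl (hg (e₁.trans e₃.symm)))
      | exact Or.inr (Or.inr (hg (e₂.trans e₃.symm)))

/-! ### The diameter of the components of a bouquet -/

/-- Two vertices lie in at most two copies of `K`, and all the other copies can be folded onto
these, so the size of two copies bounds the length. -/
theorem bouquet_exists_short_walk {W : Type v} [Finite W] (K : SimpleGraph W) (N : Set W) :
    ∃ d : ℕ, ∀ x y, (bouquet K N).Reachable x y →
      ∃ p : (bouquet K N).Walk x y, p.length ≤ d := by
  classical
  let S := N ⊕ Bool × (Nᶜ : Set W)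
  have : Fintype S := Fintype.ofFinite S
  have key : ∀ i j, ∀ x y : N ⊕ ℕ × (Nᶜ : Set W), (∀ m c, x = Sum.inr (m, c) → m = i) →
      (∀ m c, y = Sum.inr (m, c) → m = j) → (bouquet K N).Reachable x y →
      ∃ p : (bouquet K N).Walk x y, p.length ≤ Fintype.card S := by
    intro i j x y hx hy hxy
    let φ : S → N ⊕ ℕ × (Nᶜ : Set W) := Sum.map id (Prod.map (fun b => bif b then i else j) id)
    let ψ : N ⊕ ℕ × (Nᶜ : Set W) → S := Sum.map id (Prod.map (fun m => decide (m = i)) id)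
    have hφx : φ (ψ x) = x := by
      rcases x with a | ⟨m, c⟩
      · rfl
      · obtain rfl := hx m c rfl
        simp [φ, ψ]
    have hφy : φ (ψ y) = y := by
      rcases y with a | ⟨m, c⟩
      · rfl
      · obtain rfl := hy m c rfl
        by_cases h : m = i <;> simp [φ, ψ, h]
    let G : SimpleGraph S := (bouquet K N).comap φ
    let ψ' : bouquet K N →g G := ⟨ψ, by
      rintro (a | ⟨m, c⟩) (b | ⟨n, d⟩) h
      · exact h
      · exact h
      · exact h
      · exact ⟨by rw [h.1], h.2⟩⟩
    let φ' : G →g bouquet K N := ⟨φ, fun h => h⟩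
    obtain ⟨p, hp⟩ := (hxy.map ψ').exists_isPath
    refine ⟨(p.map φ').copy hφx hφy, ?_⟩
    rw [SimpleGraph.Walk.length_copy, SimpleGraph.Walk.length_map]
    exact hp.length_lt.le
  refine ⟨Fintype.card S, fun x y h => ?_⟩
  have ex : ∀ x : N ⊕ ℕ × (Nᶜ : Set W), ∃ i, ∀ m c, x = Sum.inr (m, c) → m = i := by
    rintro (a | ⟨m, c⟩)
    · exact ⟨0, by simp⟩
    · exact ⟨m, fun m' c' h => by simp only [Sum.inr.injEq, Prod.mk.injEq] at h; exact h.1.symm⟩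
  obtain ⟨i, hi⟩ := ex x
  obtain ⟨j, hj⟩ := ex y
  exact key i j x y hi hj h

/-! ### The lower bound -/

/-- The diagonal argument: the tree of chains of path states of the members of `F` has no strong
immersion into any of them. -/
theorem lift_succ_le_mk_of_isStronglyUniversal {κ : Cardinal.{u}} (hκ : Cardinal.aleph0 ≤ κ)
    {V : Type v} {B : SimpleGraph V} {d : ℕ}
    (hd : ∀ x y, B.Reachable x y → ∃ p : B.Walk x y, p.length ≤ d)
    (hB : ∃ D : B.ConnectedComponent, ¬ IsSubdivisionOfStar D.toSimpleGraph)
    {F : Set GraphObj.{u}} (hF : IsStronglyUniversal (raylessFree κ B) F) :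
    Cardinal.lift.{u + 1} (Order.succ κ) ≤ #F := by
  classical
  by_contra hlt
  rw [not_le, Cardinal.lift_succ, Order.lt_succ_iff] at hlt
  obtain ⟨c, hc⟩ := Cardinal.mem_range_lift_of_le hlt
  have hcκ : c ≤ κ := by rwa [← hc, Cardinal.lift_le] at hlt
  rw [← Cardinal.mk_out c, ← Cardinal.mk_uLift] at hc
  obtain ⟨e⟩ := Cardinal.eq.1 hc
  set ι := c.out with hι
  let H : ι → GraphObj.{u} := fun i => (e ⟨i⟩).1
  have hH : ∀ i, H i ∈ raylessFree κ B := fun i => hF.1 (e ⟨i⟩).2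
  let P := Σ i, Finset (H i).1 × (H i).1
  let R : P → P → Prop := fun p q => ∃ i a b, p = ⟨i, a⟩ ∧ q = ⟨i, b⟩ ∧ PathStep (H i).2 a b
  have hR : WellFounded R := by
    refine ⟨?_⟩
    rintro ⟨i, a⟩
    induction a using ((hH i).2.1.wellFounded_pathStep).induction with
    | _ a ih =>
      refine ⟨_, ?_⟩
      rintro _ ⟨j, a', b, rfl, h2, h3⟩
      obtain ⟨rfl, h2⟩ := Sigma.mk.inj_iff.1 h2
      obtain rfl := eq_of_heq h2
      exact ih _ h3
  -- Neighbouring branch vertices of the tree are `d + 1` path steps apart, so chains must be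
  -- allowed to skip states.
  let r := Relation.TransGen R
  have hr : WellFounded r := hR.transGen
  have hP : #P ≤ κ := by
    rw [Cardinal.mk_sigma]
    refine (Cardinal.sum_le_mk_mul_iSup _).trans ?_
    refine Cardinal.mul_le_of_le hκ (by rw [hι, Cardinal.mk_out]; exact hcκ) ?_
    refine ciSup_le' fun i => ?_
    rw [Cardinal.mk_prod, Cardinal.lift_id, Cardinal.lift_id]
    have h1 : #(H i).1 ≤ κ := (hH i).2.2.1
    refine Cardinal.mul_le_of_le hκ ?_ h1
    refine (Cardinal.mk_le_of_injective (f := fun s : Finset (H i).1 => s.toList)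
      fun s t h => by simpa using congrArg List.toFinset h).trans ?_
    exact (Cardinal.mk_list_le_max _).trans (max_le hκ h1)
  let T := {l : List P // l.IsChain r} × Fin (d + 1)
  let G : SimpleGraph T := parentGraph (chainPar r d)
  have hG : (⟨T, G⟩ : GraphObj.{u}) ∈ raylessFree κ B := by
    refine ⟨parentGraph_connected _ (chainDep_par_lt r d) _ (chainPar_eq_self r d),
      parentGraph_rayless _ (chainDep_par_lt r d) (chainPar_wellFounded hr d), ?_, ?_⟩
    · change #T ≤ κ
      rw [Cardinal.mk_prod, Cardinal.lift_uzero]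
      refine Cardinal.mul_le_of_le hκ ?_ ?_
      · exact (Cardinal.mk_subtype_le _).trans
          ((Cardinal.mk_list_le_max _).trans (max_le hκ hP))
      · rw [Cardinal.mk_fin, Cardinal.lift_natCast]
        exact (Cardinal.natCast_le_aleph0).trans hκ
    · rintro ⟨f⟩
      obtain ⟨D, hD⟩ := hB
      exact hD (isSubdivisionOfStar_of_copy_chainTree hd f D)
  obtain ⟨H', hH', ⟨φ⟩⟩ := hF.2 _ hG
  obtain ⟨i, rfl⟩ : ∃ i, H i = H' := by
    obtain ⟨⟨i⟩, hi⟩ := e.surjective ⟨H', hH'⟩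
    exact ⟨i, congrArg Subtype.val hi⟩
  let p : T → P := fun x => ⟨i, ancestorImages (chainPar r d) (chainDep r d) φ x, φ x⟩
  have hp : ∀ x, chainPar r d x ≠ x → R (p x) (p (chainPar r d x)) := fun x hx =>
    ⟨i, _, _, rfl, rfl, pathStep_ancestorImages (chainDep_par r d) φ.toHom φ.injective hx⟩
  have hp' : ∀ (a : P) (l : List P) (hl : (a :: l).IsChain r) (s : ℕ) (hs : s < d + 1),
      r (p (⟨a :: l, hl⟩, ⟨s, hs⟩)) (p (⟨l, hl.tail⟩, Fin.last d)) := by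
    intro a l hl s
    induction s with
    | zero =>
      intro hs
      exact Relation.TransGen.single (hp (⟨a :: l, hl⟩, ⟨0, hs⟩) (chainPar_cons_ne hl hs))
    | succ s ih =>
      intro hs
      exact Relation.TransGen.head (hp (⟨a :: l, hl⟩, ⟨s + 1, hs⟩) (by simp [chainPar]))
        (ih (by omega))
  -- If `a` is the state of the branch vertex of `l`, then the branch vertex of `a :: l` has a state
  -- below `a`, which can be prepended in turn.
  have main : ∀ (a : P) (l : List P) (hl : l.IsChain r), p (⟨l, hl⟩, Fin.last d) = a →
      (a :: l).IsChain r → False := by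
    intro a
    induction a using hr.induction with
    | _ a ih =>
      intro l hl ha hal
      have h1 := hp' a l hal d (by omega)
      change r (p (⟨a :: l, hal⟩, Fin.last d)) _ at h1
      rw [ha] at h1
      exact ih _ h1 (a :: l) hal rfl (List.isChain_cons_cons.2 ⟨h1, hal⟩)
  exact main _ [] List.IsChain.nil rfl (List.isChain_singleton _)


/-! ### Labelled graphs, their types, and cones -/

/-- A non-empty graph whose vertices carry sets of labels from `Fin k`. -/
structure LGraph (k : ℕ) where
  /-- the vertices -/
  V : Type u
  /-- the graph -/
  G : SimpleGraph V
  /-- the labels of a vertex -/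
  lab : V → Set (Fin k)
  nonempty : Nonempty V

/-- `f` restricted to `X` is an immersion of the graph induced by `K` on `X`, with the labels `ℓ`,
in a labelled graph. -/
def LGraph.Imm {k : ℕ} (A : LGraph.{u} k) {W : Type} (K : SimpleGraph W) (X : Set W)
    (ℓ : W → Set (Fin k)) (f : W → A.V) : Prop :=
  Set.InjOn f X ∧ (∀ x ∈ X, ∀ y ∈ X, K.Adj x y → A.G.Adj (f x) (f y)) ∧
    ∀ x ∈ X, ℓ x ⊆ A.lab (f x)

/-- The maps `f i` are the restrictions to the individual copies of an immersion of the bouquet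
with stem `M` of the graph induced by `K` on `M ∪ Nᶜ`, with the labels `ℓ`. -/
def LGraph.BImm {k : ℕ} (A : LGraph.{u} k) {W : Type} (K : SimpleGraph W) (N M : Set W)
    (ℓ : W → Set (Fin k)) (f : ℕ → W → A.V) : Prop :=
  (∀ i, A.Imm K (M ∪ Nᶜ) ℓ (f i)) ∧ (∀ i, Set.EqOn (f i) (f 0) M) ∧
    ∀ i j, i ≠ j → ∀ x ∈ Nᶜ, ∀ y ∈ Nᶜ, f i x ≠ f j y

/-- Pairs consisting of a vertex set and a labelling. -/
abbrev Pattern (W : Type) (k : ℕ) : Type := Set W × (W → Set (Fin k))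

/-- The type of a labelled graph: the finite patterns and the bouquets that it contains. -/
def LGraph.tp {k : ℕ} (A : LGraph.{u} k) {W : Type} (K : SimpleGraph W) (N : Set W) :
    Set (Pattern W k) × Set (Pattern W k) :=
  ({p | ∃ f, A.Imm K p.1 p.2 f}, {p | ∃ f, A.BImm K N p.1 p.2 f})

/-- The disjoint union of the graphs `A i` together with a new vertex, which is joined to the
vertices with label `0`. -/
def cone {k : ℕ} {I : Type u} (A : I → LGraph.{u} (k + 1)) (s : Set (Fin k)) : LGraph.{u} k where
  V := Option (Σ i, (A i).V)
  G :=
    { Adj := fun x y => match x, y with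
        | none, none => False
        | none, some q => 0 ∈ (A q.1).lab q.2
        | some p, none => 0 ∈ (A p.1).lab p.2
        | some p, some q => ∃ i a b, p = ⟨i, a⟩ ∧ q = ⟨i, b⟩ ∧ (A i).G.Adj a b
      symm := ⟨by
        rintro (_ | p) (_ | q) h
        · exact h
        · exact h
        · exact h
        · obtain ⟨i, a, b, rfl, rfl, h⟩ := h
          exact ⟨i, b, a, rfl, rfl, h.symm⟩⟩
      loopless := ⟨by
        rintro (_ | p) h
        · exact h
        · obtain ⟨i, a, b, h1, h2, h⟩ := h
          rw [h1] at h2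
          obtain ⟨_, h3⟩ := Sigma.mk.inj_iff.1 h2
          exact h.ne (eq_of_heq h3)⟩ }
  lab
    | none => s
    | some p => Fin.succ ⁻¹' (A p.1).lab p.2
  nonempty := ⟨none⟩

section Cone

variable {k : ℕ} {I I' : Type u} {A : I → LGraph.{u} (k + 1)} {A' : I' → LGraph.{u} (k + 1)}
  {s : Set (Fin k)} {W : Type} {K : SimpleGraph W} {N : Set W}

theorem cone_adj_some {i : I} {a b : (A i).V} :
    (cone A s).G.Adj (some ⟨i, a⟩) (some ⟨i, b⟩) ↔ (A i).G.Adj a b := by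
  constructor
  · rintro ⟨j, a', b', h1, h2, h⟩
    obtain ⟨rfl, h1⟩ := Sigma.mk.inj_iff.1 h1
    obtain rfl := eq_of_heq h1
    obtain ⟨_, h2⟩ := Sigma.mk.inj_iff.1 h2
    obtain rfl := eq_of_heq h2
    exact h
  · intro h
    exact ⟨i, a, b, rfl, rfl, h⟩

theorem cone_adj_fst {p q : Σ i, (A i).V} (h : (cone A s).G.Adj (some p) (some q)) :
    p.1 = q.1 := by
  obtain ⟨i, a, b, rfl, rfl, _⟩ := h
  rfl

/-- The labels of a pattern in the cone, once the apex has been removed; the vertices in `Z` are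
those at the apex. -/
def extLab (K : SimpleGraph W) (Z : Set W) (ℓ : W → Set (Fin k)) (x : W) : Set (Fin (k + 1)) :=
  {i | Fin.cases (motive := fun _ => Prop) (∃ y ∈ Z, K.Adj y x) (fun i => i ∈ ℓ x) i}

theorem zero_mem_extLab {Z : Set W} {ℓ : W → Set (Fin k)} {x : W} :
    0 ∈ extLab K Z ℓ x ↔ ∃ y ∈ Z, K.Adj y x := Iff.rfl

theorem succ_mem_extLab {Z : Set W} {ℓ : W → Set (Fin k)} {x : W} {i : Fin k} :
    i.succ ∈ extLab K Z ℓ x ↔ i ∈ ℓ x := Iff.rfl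

/-- The set of vertices of `X` that are mapped to the `j`-th summand of a cone. -/
def piece (f : W → (cone A s).V) (X : Set W) (j : I) : Set W :=
  {x | x ∈ X ∧ ∃ a, f x = some ⟨j, a⟩}

/-- The set of vertices of `X` that are mapped to the apex of a cone. -/
def apexSet (f : W → (cone A s).V) (X : Set W) : Set W := {x | x ∈ X ∧ f x = none}

/-- The projection of a cone to one of its summands. -/
noncomputable def coneProj (A : I → LGraph.{u} (k + 1)) (s : Set (Fin k)) (j : I) :
    (cone A s).V → (A j).V :=
  open Classical in fun x =>
    if h : ∃ a : (A j).V, x = some ⟨j, a⟩ then h.choose else (A j).nonempty.some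

theorem coneProj_some (j : I) (a : (A j).V) : coneProj A s j (some ⟨j, a⟩) = a := by
  have h : ∃ b : (A j).V, (some ⟨j, a⟩ : (cone A s).V) = some ⟨j, b⟩ := ⟨a, rfl⟩
  refine (dif_pos h).trans ?_
  have := h.choose_spec
  have h1 := (Sigma.mk.inj_iff.1 (Option.some.inj this)).2
  exact (eq_of_heq h1).symm

/-- Inside a summand, adjacency to a pattern vertex placed at the apex survives as label `0`. -/
theorem imm_coneProj {X : Set W} {ℓ : W → Set (Fin k)} {f : W → (cone A s).V}
    (hf : (cone A s).Imm K X ℓ f) (j : I) :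
    (A j).Imm K (piece f X j) (extLab K (apexSet f X) ℓ) (fun x => coneProj A s j (f x)) := by
  obtain ⟨h1, h2, h3⟩ := hf
  refine ⟨?_, ?_, ?_⟩
  · rintro x ⟨hx, a, ha⟩ y ⟨hy, b, hb⟩ h
    simp only [ha, hb, coneProj_some] at h
    exact h1 hx hy (by rw [ha, hb, h])
  · rintro x ⟨hx, a, ha⟩ y ⟨hy, b, hb⟩ h
    have := h2 x hx y hy h
    simp only [ha, hb, coneProj_some] at this ⊢
    exact cone_adj_some.1 this
  · rintro x ⟨hx, a, ha⟩ i hi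
    simp only [ha, coneProj_some]
    induction i using Fin.cases with
    | zero =>
      obtain ⟨y, ⟨hy, hy0⟩, hyx⟩ := zero_mem_extLab.1 hi
      have := h2 y hy x hx hyx
      rw [hy0, ha] at this
      exact this
    | succ i =>
      have := h3 x hx (succ_mem_extLab.1 hi)
      rw [ha] at this
      exact this

/-- Replace the summands of a cone that a map `f` meets. -/
def glue (g : I' → W → Σ i, (A i).V) (f : W → (cone A' s).V) : W → (cone A s).V :=
  fun x => match f x with
    | none => none
    | some p => some (g p.1 x)

/-- Different summands communicate only through the apex, and label `0` supplies those edges; so the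
pieces can be moved independently, as long as summands that are met stay distinct. Writing the
target index as a variable `i` equal to `φ j` avoids casts when `φ` is defined by cases. -/
theorem imm_glue {X : Set W} {ℓ : W → Set (Fin k)} {f : W → (cone A' s).V}
    (hf : (cone A' s).Imm K X ℓ f) (φ : I' → I) (g : I' → W → Σ i, (A i).V)
    (hφ : Set.InjOn φ {j | ∃ x ∈ X, ∃ a, f x = some ⟨j, a⟩})
    (hg : ∀ j, ∃ i, φ j = i ∧ ∃ g' : W → (A i).V,
      (A i).Imm K (piece f X j) (extLab K (apexSet f X) ℓ) g' ∧ ∀ x, g j x = ⟨i, g' x⟩) :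
    (cone A s).Imm K X ℓ (glue g f) := by
  obtain ⟨h1, h2, h3⟩ := hf
  have glue_none : ∀ x, f x = none → glue (A := A) (s := s) g f x = none := by
    intro x hx; simp only [glue, hx]; rfl
  have glue_some : ∀ x p, f x = some p → glue (A := A) (s := s) g f x = some (g p.1 x) := by
    intro x hx h; simp only [glue, h]; rfl
  have apex : ∀ x ∈ X, ∀ y ∈ X, ∀ p, f x = none → f y = some p → K.Adj x y →
      (cone A s).G.Adj none (some (g p.1 y)) := by
    rintro x hx y hy ⟨j, a⟩ hfx hfy hxy
    obtain ⟨i, _, g', hg', hgj⟩ := hg j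
    rw [hgj]
    exact hg'.2.2 y ⟨hy, a, hfy⟩ (zero_mem_extLab.2 ⟨x, ⟨hx, hfx⟩, hxy⟩)
  refine ⟨?_, ?_, ?_⟩
  · intro x hx y hy h
    rcases hfx : f x with _ | ⟨j, a⟩ <;> rcases hfy : f y with _ | ⟨j', b⟩
    · exact h1 hx hy (hfx.trans hfy.symm)
    · rw [glue_none _ hfx, glue_some _ _ hfy] at h; cases h
    · rw [glue_none _ hfy, glue_some _ _ hfx] at h; cases h
    · rw [glue_some _ _ hfx, glue_some _ _ hfy] at h
      have h := Option.some.inj h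
      simp only at h
      obtain ⟨i, hi, g', hg', hgj⟩ := hg j
      obtain ⟨i', hi', g'', hg'', hgj'⟩ := hg j'
      rw [hgj, hgj'] at h
      obtain ⟨e, h⟩ := Sigma.mk.inj_iff.1 h
      have hj : j = j' := hφ ⟨x, hx, a, hfx⟩ ⟨y, hy, b, hfy⟩ (by rw [hi, hi', e])
      subst hj
      subst e
      have h6 := hgj y
      rw [hgj'] at h6
      have h6 := eq_of_heq (Sigma.mk.inj_iff.1 h6).2
      have h := eq_of_heq h
      rw [h6] at h
      exact hg'.1 ⟨hx, a, hfx⟩ ⟨hy, b, hfy⟩ h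
  · intro x hx y hy hxy
    have hadj := h2 x hx y hy hxy
    rcases hfx : f x with _ | ⟨j, a⟩ <;> rcases hfy : f y with _ | ⟨j', b⟩
    · rw [hfx, hfy] at hadj; exact hadj.elim
    · rw [glue_none _ hfx, glue_some _ _ hfy]
      exact apex x hx y hy _ hfx hfy hxy
    · rw [glue_none _ hfy, glue_some _ _ hfx]
      exact (apex y hy x hx _ hfy hfx hxy.symm).symm
    · rw [hfx, hfy] at hadj
      obtain rfl : j = j' := cone_adj_fst hadj
      rw [glue_some _ _ hfx, glue_some _ _ hfy]
      obtain ⟨i, hi, g', hg', hgj⟩ := hg j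
      simp only [hgj]
      exact cone_adj_some.2 (hg'.2.1 x ⟨hx, a, hfx⟩ y ⟨hy, b, hfy⟩ hxy)
  · intro x hx l hl
    have hlab := h3 x hx hl
    rcases hfx : f x with _ | ⟨j, a⟩
    · rw [glue_none _ hfx]
      rw [hfx] at hlab
      exact hlab
    · rw [glue_some _ _ hfx]
      obtain ⟨i, hi, g', hg', hgj⟩ := hg j
      simp only [hgj]
      exact hg'.2.2 x ⟨hx, a, hfx⟩ (succ_mem_extLab.2 hl)

end Cone


/-! ### The type of a cone in terms of the types of its summands -/

section ConeTypes

variable {k : ℕ} {I I' : Type u} {A : I → LGraph.{u} (k + 1)} {A' : I' → LGraph.{u} (k + 1)}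
  {s : Set (Fin k)} {W : Type} {K : SimpleGraph W} {N : Set W}

theorem LGraph.BImm.comp {B : LGraph.{u} k} {M : Set W} {ℓ : W → Set (Fin k)}
    {f : ℕ → W → B.V} (hf : B.BImm K N M ℓ f) {σ : ℕ → ℕ} (hσ : Function.Injective σ) :
    B.BImm K N M ℓ (fun i => f (σ i)) :=
  ⟨fun _ => hf.1 _, fun _ _ hx => (hf.2.1 _ hx).trans (hf.2.1 _ hx).symm,
    fun _ _ hij => hf.2.2 _ _ fun h => hij (hσ h)⟩

/-- For each type, infinitely many of the `A i` have it, or at least as many of the `A i` as of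
the `A' i`. -/
def TypeDominated (K : SimpleGraph W) (N : Set W) (A : I → LGraph.{u} (k + 1))
    (A' : I' → LGraph.{u} (k + 1)) : Prop :=
  ∀ t, Infinite {i // (A i).tp K N = t} ∨
    ∃ e : {i // (A' i).tp K N = t} → {i // (A i).tp K N = t}, Function.Injective e

/-- Injectivity is needed only on a finite set, so an infinite fibre of the target always has enough
room. -/
theorem TypeDominated.exists_injOn (h : TypeDominated K N A A') {F : Set I'} (hF : F.Finite) :
    ∃ φ : I' → I, (∀ j, (A (φ j)).tp K N = (A' j).tp K N) ∧ Set.InjOn φ F := by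
  classical
  obtain ⟨ν, hν⟩ : ∃ ν : I' → ℕ, Set.InjOn ν F := Set.countable_iff_exists_injOn.1 hF.countable
  have key : ∀ t, ∃ e : {i // (A' i).tp K N = t} → {i // (A i).tp K N = t},
      ∀ x y, x.1 ∈ F → y.1 ∈ F → e x = e y → x = y := by
    intro t
    rcases h t with h | ⟨e, he⟩
    · refine ⟨fun x => Infinite.natEmbedding _ (ν x.1), fun x y hx hy hxy => ?_⟩
      exact Subtype.ext (hν hx hy ((Infinite.natEmbedding _).injective hxy))
    · exact ⟨e, fun x y _ _ hxy => he hxy⟩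
  choose e he using key
  refine ⟨fun j => (e _ ⟨j, rfl⟩).1, fun j => (e _ ⟨j, rfl⟩).2, ?_⟩
  intro x hx y hy hxy
  have ht : (A' x).tp K N = (A' y).tp K N := by
    rw [← (e _ ⟨x, rfl⟩).2, ← (e _ ⟨y, rfl⟩).2]
    simp only at hxy
    rw [hxy]
  have hcast : ∀ t (hx' : (A' x).tp K N = t) (hy' : (A' y).tp K N = t),
      (e t ⟨x, hx'⟩).1 = (e t ⟨y, hy'⟩).1 → x = y := fun t hx' hy' h =>
    congrArg Subtype.val (he t ⟨x, hx'⟩ ⟨y, hy'⟩ hx hy (Subtype.ext h))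
  refine hcast _ ht rfl (Eq.trans ?_ hxy)
  have hx' : ∀ t (hx' : (A' x).tp K N = t), (e t ⟨x, hx'⟩).1 = (e _ ⟨x, rfl⟩).1 := by
    rintro _ rfl; rfl
  exact hx' _ ht

theorem exists_imm_piece {φ : I' → I} (hφ : ∀ j, (A (φ j)).tp K N = (A' j).tp K N) {X : Set W}
    {ℓ : W → Set (Fin k)} {f : W → (cone A' s).V} (hf : (cone A' s).Imm K X ℓ f) (j : I') :
    ∃ g : W → (A (φ j)).V,
      (A (φ j)).Imm K (piece f X j) (extLab K (apexSet f X) ℓ) g := by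
  have h1 : ((piece f X j, extLab K (apexSet f X) ℓ) : Pattern W (k + 1)) ∈
      ((A' j).tp K N).1 := ⟨_, imm_coneProj hf j⟩
  rw [← hφ j] at h1
  exact h1

theorem finite_hit [Finite W] (f : W → (cone A' s).V) (X : Set W) :
    {j | ∃ x ∈ X, ∃ a, f x = some ⟨j, a⟩}.Finite := by
  classical
  refine ((Set.finite_range f).image
    (fun v : Option (Σ i, (A' i).V) => v.map fun p => p.1)).preimage
    (Option.some_injective _).injOn |>.subset ?_
  rintro j ⟨x, _, a, hx⟩
  exact ⟨f x, ⟨x, rfl⟩, by rw [hx]; rfl⟩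

theorem tp_cone_fst_subset [Finite W] (h : TypeDominated K N A A') :
    ((cone A' s).tp K N).1 ⊆ ((cone A s).tp K N).1 := by
  rintro ⟨X, ℓ⟩ ⟨f, hf⟩
  obtain ⟨φ, hφ, hinj⟩ := h.exists_injOn (finite_hit f X)
  choose g hg using exists_imm_piece hφ hf
  exact ⟨_, imm_glue hf φ (fun j x => ⟨φ j, g j x⟩) hinj
    fun j => ⟨φ j, rfl, g j, hg j, fun _ => rfl⟩⟩

/-- This is where connectedness of `K - N` enters: a walk that avoids the apex cannot change
summands. -/
theorem exists_mem_summand (hK : (K.induce Nᶜ).Connected) {X : Set W} (hX : Nᶜ ⊆ X)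
    {ℓ : W → Set (Fin k)} {f : W → (cone A' s).V} (hf : (cone A' s).Imm K X ℓ f)
    (h0 : ∀ x ∈ Nᶜ, f x ≠ none) : ∃ j, ∀ x ∈ Nᶜ, ∃ a, f x = some ⟨j, a⟩ := by
  obtain ⟨x₀⟩ := hK.nonempty
  obtain ⟨⟨j, a₀⟩, h₀⟩ := Option.ne_none_iff_exists'.1 (h0 x₀ x₀.2)
  refine ⟨j, fun x hx => ?_⟩
  obtain ⟨p⟩ := hK.preconnected x₀ ⟨x, hx⟩
  have : ∀ {y z : (Nᶜ : Set W)} (_ : (K.induce Nᶜ).Walk y z), (∃ a, f y = some ⟨j, a⟩) →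
      ∃ a, f z = some ⟨j, a⟩ := by
    intro y z p
    induction p with
    | nil => exact id
    | @cons y w z hyw p ih =>
      rintro ⟨a, ha⟩
      apply ih
      have hadj := hf.2.1 y (hX y.2) w (hX w.2) hyw
      obtain ⟨⟨j', b⟩, hb⟩ := Option.ne_none_iff_exists'.1 (h0 w w.2)
      rw [ha, hb] at hadj
      obtain rfl : j = j' := cone_adj_fst hadj
      exact ⟨b, hb⟩
  exact this p ⟨a₀, h₀⟩

/-- Replacing the summands met by a bouquet in a cone, where the `i`-th copy of `K - N` lies in the
summand `c i`. -/
theorem bimm_glue {M : Set W} {ℓ : W → Set (Fin k)} {f : ℕ → W → (cone A' s).V}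
    (hf : (cone A' s).BImm K N M ℓ f) {c : ℕ → I'}
    (hc : ∀ i, ∀ x ∈ Nᶜ, ∃ a, f i x = some ⟨c i, a⟩) (φ : I' → I) (ψ : ℕ → I)
    (p : ∀ i, W → (A (ψ i)).V) (g : ∀ j, W → (A (φ j)).V)
    (h1 : ∀ i, (A (ψ i)).Imm K (piece (f i) (M ∪ Nᶜ) (c i))
      (extLab K (apexSet (f 0) M) ℓ) (p i))
    (h2 : ∀ j, (A (φ j)).Imm K (piece (f 0) M j) (extLab K (apexSet (f 0) M) ℓ) (g j))
    (h3 : ∀ i, ∀ j ∈ {j | ∃ x ∈ M, ∃ a, f 0 x = some ⟨j, a⟩}, j ≠ c i → φ j ≠ ψ i)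
    (h3' : Set.InjOn φ {j | ∃ x ∈ M, ∃ a, f 0 x = some ⟨j, a⟩})
    (h4 : ∀ i j, i ≠ j → ∀ x ∈ Nᶜ, ∀ y ∈ Nᶜ,
      (⟨ψ i, p i x⟩ : Σ i, (A i).V) ≠ ⟨ψ j, p j y⟩)
    (h5 : ∀ i i', ∀ x ∈ M, (∃ a, f 0 x = some ⟨c i, a⟩) → c i' = c i ∧
      (⟨ψ i', p i' x⟩ : Σ i, (A i).V) = ⟨ψ i, p i x⟩) :
    ∃ f' : ℕ → W → (cone A s).V, (cone A s).BImm K N M ℓ f' := by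
  classical
  have hapex : ∀ i, apexSet (f i) (M ∪ Nᶜ) = apexSet (f 0) M := by
    intro i
    ext x
    constructor
    · rintro ⟨hx | hx, h⟩
      · exact ⟨hx, by rw [← hf.2.1 i hx, h]⟩
      · obtain ⟨a, ha⟩ := hc i x hx
        rw [ha] at h; cases h
    · rintro ⟨hx, h⟩
      exact ⟨Or.inl hx, by rw [hf.2.1 i hx, h]⟩
  have hpiece : ∀ i j, j ≠ c i → piece (f i) (M ∪ Nᶜ) j = piece (f 0) M j := by
    intro i j hj
    ext x
    constructor
    · rintro ⟨hx | hx, a, h⟩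
      · exact ⟨hx, a, by rw [← hf.2.1 i hx, h]⟩
      · obtain ⟨b, hb⟩ := hc i x hx
        rw [hb] at h
        exact absurd (Sigma.mk.inj_iff.1 (Option.some.inj h)).1.symm hj
    · rintro ⟨hx, a, h⟩
      exact ⟨Or.inl hx, a, by rw [hf.2.1 i hx, h]⟩
  -- In the summand of the `i`-th copy, `p i` moves that copy together with the stem vertices there.
  -- The other summands meet only the stem, and `g` moves them in the same way for every `i`.
  let g' : ℕ → I' → W → Σ i, (A i).V := fun i j x =>
    if j = c i then ⟨ψ i, p i x⟩ else ⟨φ j, g j x⟩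
  have glueN : ∀ i, ∀ x ∈ Nᶜ,
      glue (A := A) (s := s) (g' i) (f i) x = some ⟨ψ i, p i x⟩ := by
    intro i x hx
    obtain ⟨a, ha⟩ := hc i x hx
    simp only [glue, ha, g', if_true]
    rfl
  refine ⟨fun i => glue (g' i) (f i), fun i => ?_, fun i x hx => ?_, ?_⟩
  · refine imm_glue (hf.1 i) (fun j => if j = c i then ψ i else φ j) (g' i) ?_ ?_
    · have hmem : ∀ j, j ≠ c i → j ∈ {j | ∃ x ∈ M ∪ Nᶜ, ∃ a, f i x = some ⟨j, a⟩} →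
          j ∈ {j | ∃ x ∈ M, ∃ a, f 0 x = some ⟨j, a⟩} := by
        rintro j hj ⟨x, hx, a, ha⟩
        have : x ∈ piece (f i) (M ∪ Nᶜ) j := ⟨hx, a, ha⟩
        rw [hpiece i j hj] at this
        exact ⟨x, this.1, this.2⟩
      intro j hj j' hj' h
      simp only at h
      by_cases e : j = c i <;> by_cases e' : j' = c i
      · rw [e, e']
      · rw [if_pos e, if_neg e'] at h
        exact absurd h.symm (h3 i j' (hmem j' e' hj') e')
      · rw [if_pos e', if_neg e] at h
        exact absurd h (h3 i j (hmem j e hj) e)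
      · rw [if_neg e, if_neg e'] at h
        exact h3' (hmem j e hj) (hmem j' e' hj') h
    · intro j
      rw [hapex]
      by_cases e : j = c i
      · subst e
        exact ⟨ψ i, if_pos rfl, p i, h1 i, fun x => if_pos rfl⟩
      · refine ⟨φ j, if_neg e, g j, ?_, fun x => if_neg e⟩
        rw [hpiece i j e]
        exact h2 j
  · have hfi := hf.2.1 i hx
    simp only [glue, hfi]
    rcases h0 : f 0 x with _ | ⟨j, a⟩
    · rfl
    · refine congrArg some ?_
      simp only [g']
      by_cases e : j = c i
      · subst e
        obtain ⟨e1, e2⟩ := h5 i 0 x hx ⟨a, h0⟩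
        rw [if_pos rfl, if_pos e1.symm, e2]
      · by_cases e' : j = c 0
        · subst e'
          exact absurd (h5 0 i x hx ⟨a, h0⟩).1.symm e
        · rw [if_neg e, if_neg e']
  · intro i j hij x hx y hy h
    simp only [glueN i x hx, glueN j y hy] at h
    exact h4 i j hij x hx y hy (Option.some.inj h)

/-- By the pigeonhole principle either infinitely many copies share a summand, which then contains a
bouquet on a smaller stem, or infinitely many summands of one type contain a copy each. Smaller
stems are why types record bouquets for every `M`. -/
theorem tp_cone_snd_subset [Finite W] (hK : (K.induce Nᶜ).Connected)
    (h : TypeDominated K N A A') :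
    ((cone A' s).tp K N).2 ⊆ ((cone A s).tp K N).2 := by
  classical
  rintro ⟨M, ℓ⟩ ⟨f, hf⟩
  simp only at hf
  change ∃ f' : ℕ → W → (cone A s).V, (cone A s).BImm K N M ℓ f'
  -- Outside the stem the copies are disjoint, so at most one uses the apex; that copy and those
  -- before it are dropped.
  wlog h0 : ∀ i, ∀ x ∈ Nᶜ, f i x ≠ none generalizing f
  · push Not at h0
    obtain ⟨i₀, x₀, hx₀, h₀⟩ := h0
    refine this (fun i => f (i + (i₀ + 1))) (hf.comp (add_left_injective (i₀ + 1))) ?_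
    intro i x hx hi
    exact hf.2.2 (i + (i₀ + 1)) i₀ (by omega) x hx x₀ hx₀ (hi.trans h₀.symm)
  choose c hc using fun i => exists_mem_summand hK Set.subset_union_right (hf.1 i) (h0 i)
  by_cases hfib : ∃ c₀, {i | c i = c₀}.Infinite
  · -- infinitely many copies in the same summand
    obtain ⟨c₀, hinf⟩ := hfib
    let σ := hinf.natEmbedding
    replace hf := hf.comp (σ := fun i => (σ i : ℕ))
      (fun i j h => σ.injective (Subtype.ext h))
    replace hc : ∀ i, ∀ x ∈ Nᶜ, ∃ a, f (σ i) x = some ⟨c₀, a⟩ := by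
      intro i x hx
      obtain ⟨a, ha⟩ := hc (σ i) x hx
      have e : c (σ i) = c₀ := (σ i).2
      clear_value σ
      exact (fun c' (e : c (σ i) = c') => by subst e; exact ⟨a, ha⟩ :
        ∀ c', c (σ i) = c' → ∃ a, f (σ i) x = some ⟨c', a⟩) c₀ e
    generalize hF : (fun i => f (σ i)) = F at hf
    replace hc : ∀ i, ∀ x ∈ Nᶜ, ∃ a, F i x = some ⟨c₀, a⟩ := by
      rw [← hF]; exact hc
    have hapex : ∀ i, apexSet (F i) (M ∪ Nᶜ) = apexSet (F 0) M := by
      intro i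
      ext x
      constructor
      · rintro ⟨hx | hx, h⟩
        · exact ⟨hx, by rw [← hf.2.1 i hx, h]⟩
        · obtain ⟨a, ha⟩ := hc i x hx
          rw [ha] at h; cases h
      · rintro ⟨hx, h⟩
        exact ⟨Or.inl hx, by rw [hf.2.1 i hx, h]⟩
    have hpiece : ∀ i, piece (F i) (M ∪ Nᶜ) c₀ = piece (F 0) M c₀ ∪ Nᶜ := by
      intro i
      ext x
      constructor
      · rintro ⟨hx | hx, a, h⟩
        · exact Or.inl ⟨hx, a, by rw [← hf.2.1 i hx, h]⟩
        · exact Or.inr hx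
      · rintro (⟨hx, a, h⟩ | hx)
        · exact ⟨Or.inl hx, a, by rw [hf.2.1 i hx, h]⟩
        · exact ⟨Or.inr hx, hc i x hx⟩
    obtain ⟨φ, hφ, hinj⟩ := h.exists_injOn ((finite_hit (F 0) M).insert c₀)
    have hb : ((piece (F 0) M c₀, extLab K (apexSet (F 0) M) ℓ) : Pattern W (k + 1)) ∈
        ((A' c₀).tp K N).2 := by
      refine ⟨fun i x => coneProj A' s c₀ (F i x), fun i => ?_, fun i x hx => ?_, ?_⟩
      · have := imm_coneProj (hf.1 i) c₀
        rw [hapex, hpiece] at this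
        exact this
      · simp only [hf.2.1 i hx.1]
      · intro i j hij x hx y hy e
        obtain ⟨a, ha⟩ := hc i x hx
        obtain ⟨b, hb⟩ := hc j y hy
        simp only [ha, hb, coneProj_some] at e
        exact hf.2.2 i j hij x hx y hy (by rw [ha, hb, e])
    rw [← hφ c₀] at hb
    obtain ⟨p, hp⟩ := hb
    have hf0 : (cone A' s).Imm K M ℓ (F 0) := by
      obtain ⟨a1, a2, a3⟩ := hf.1 0
      exact ⟨a1.mono Set.subset_union_left, fun x hx y hy => a2 x (Or.inl hx) y (Or.inl hy),
        fun x hx => a3 x (Or.inl hx)⟩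
    choose g hg using exists_imm_piece hφ hf0
    refine bimm_glue hf (c := fun _ => c₀) hc φ (fun _ => φ c₀) p g ?_ hg ?_ ?_ ?_ ?_
    · intro i
      rw [hpiece]
      exact hp.1 i
    · intro i j hj hne e
      exact hne (hinj (Set.mem_insert_of_mem _ hj) (Set.mem_insert _ _) e)
    · exact hinj.mono (Set.subset_insert _ _)
    · intro i j hij x hx y hy e
      exact hp.2.2 i j hij x hx y hy (eq_of_heq (Sigma.mk.inj_iff.1 e).2)
    · intro i i' x hx hx'
      refine ⟨rfl, ?_⟩
      have : x ∈ piece (F 0) M c₀ := ⟨hx, hx'⟩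
      rw [hp.2.1 i this, hp.2.1 i' this]
  · -- every summand contains only finitely many copies
    replace hfib : ∀ c₀, {i | c i = c₀}.Finite := fun c₀ =>
      Set.not_infinite.1 fun hc₀ => hfib ⟨c₀, hc₀⟩
    have hhit := finite_hit (f 0) M
    set H := {j | ∃ x ∈ M, ∃ a, f 0 x = some ⟨j, a⟩} with hH
    -- There are only finitely many types, since `W` and the set of labels are finite.
    obtain ⟨t, ht⟩ := Finite.exists_infinite_fiber fun i : ℕ => (A' (c i)).tp K N
    rw [Set.infinite_coe_iff] at ht
    have hbad : {i | c i ∈ H}.Finite := by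
      have : {i | c i ∈ H} = ⋃ j ∈ H, {i | c i = j} := by ext; simp
      rw [this]
      exact hhit.biUnion fun j _ => hfib j
    have hS := ht.sdiff hbad
    generalize hSdef : ((fun i : ℕ => (A' (c i)).tp K N) ⁻¹' {t} \ {i | c i ∈ H}) = S at hS
    have hcS : (c '' S).Infinite := by
      intro hfin
      exact hS (Set.Finite.of_finite_fibers c hfin
        fun x _ => (hfib x).subset fun i hi => hi.2)
    let τ := hcS.natEmbedding
    have hex : ∀ n, ∃ i ∈ S, c i = (τ n : I') := fun n => (τ n).2
    choose σ hσS hσ using hex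
    have hcσ : Function.Injective fun n => c (σ n) := by
      intro n m hnm
      simp only [hσ] at hnm
      exact τ.injective (Subtype.ext hnm)
    have htσ : ∀ n, (A' (c (σ n))).tp K N = t := fun n => by
      have := hσS n; rw [← hSdef] at this; exact this.1
    have hHσ : ∀ n, c (σ n) ∉ H := fun n => by
      have := hσS n; rw [← hSdef] at this; exact this.2
    have hσinj : Function.Injective σ := fun n m e => hcσ (congrArg c e)
    have hinf : {i | (A i).tp K N = t}.Infinite := by
      rw [← Set.infinite_coe_iff]
      rcases h t with h | ⟨e, he⟩
      · exact h
      · exact Infinite.of_injective (fun n => e ⟨c (σ n), htσ n⟩)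
          fun n m hnm => hcσ (congrArg Subtype.val (he hnm))
    obtain ⟨φ, hφ, hinj⟩ := h.exists_injOn hhit
    -- The copies go to pairwise distinct summands of type `t` that are not reserved for the stem.
    have hinf' := hinf.sdiff (hhit.image φ)
    let ψ := hinf'.natEmbedding
    have hψt : ∀ n, (A (ψ n)).tp K N = t := fun n => (ψ n).2.1
    have hψH : ∀ n, (ψ n : I) ∉ φ '' H := fun n => (ψ n).2.2
    have hf' := hf.comp hσinj
    have hc' : ∀ n, ∀ x ∈ Nᶜ, ∃ a, f (σ n) x = some ⟨c (σ n), a⟩ := fun n => hc (σ n)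
    have hMeq : ∀ x ∈ M, f (σ 0) x = f 0 x := fun x hx => hf.2.1 _ hx
    have hapex : ∀ n, apexSet (f (σ n)) (M ∪ Nᶜ) = apexSet (f (σ 0)) M := by
      intro n
      ext x
      constructor
      · rintro ⟨hx | hx, h⟩
        · exact ⟨hx, by rw [hf.2.1 _ hx, ← hf.2.1 (σ n) hx, h]⟩
        · obtain ⟨a, ha⟩ := hc' n x hx
          rw [ha] at h; cases h
      · rintro ⟨hx, h⟩
        exact ⟨Or.inl hx, by rw [hf.2.1 _ hx, ← hf.2.1 (σ 0) hx, h]⟩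
    have hpx : ∀ n, ∃ p : W → (A (ψ n)).V,
        (A (ψ n)).Imm K (piece (f (σ n)) (M ∪ Nᶜ) (c (σ n)))
          (extLab K (apexSet (f (σ 0)) M) ℓ) p := by
      intro n
      have h1 := imm_coneProj (hf.1 (σ n)) (c (σ n))
      rw [hapex] at h1
      have h2 : ((piece (f (σ n)) (M ∪ Nᶜ) (c (σ n)), extLab K (apexSet (f (σ 0)) M) ℓ) :
          Pattern W (k + 1)) ∈ ((A' (c (σ n))).tp K N).1 := ⟨_, h1⟩
      rw [htσ, ← hψt n] at h2
      exact h2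
    choose p hp using hpx
    have hf0 : (cone A' s).Imm K M ℓ (f (σ 0)) := by
      obtain ⟨a1, a2, a3⟩ := hf.1 (σ 0)
      exact ⟨a1.mono Set.subset_union_left, fun x hx y hy => a2 x (Or.inl hx) y (Or.inl hy),
        fun x hx => a3 x (Or.inl hx)⟩
    choose g hg using exists_imm_piece hφ hf0
    have hHeq : {j | ∃ x ∈ M, ∃ a, f (σ 0) x = some ⟨j, a⟩} = H := by
      ext j
      constructor
      · rintro ⟨x, hx, a, ha⟩; exact ⟨x, hx, a, by rw [← hMeq x hx, ha]⟩
      · rintro ⟨x, hx, a, ha⟩; exact ⟨x, hx, a, by rw [hMeq x hx, ha]⟩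
    refine bimm_glue hf' (c := fun n => c (σ n)) hc' φ (fun n => ψ n) p g hp hg ?_ ?_ ?_ ?_
    · intro n j hj _ e
      rw [hHeq] at hj
      exact hψH n ⟨j, hj, e⟩
    · rw [hHeq]; exact hinj
    · intro n m hnm x _ y _ e
      exact hnm (ψ.injective (Subtype.ext (Sigma.mk.inj_iff.1 e).1))
    · rintro n m x hx ⟨a, ha⟩
      rw [hMeq x hx] at ha
      exact absurd ⟨x, hx, a, ha⟩ (hHσ n)

end ConeTypes


/-! ### Type-preserving strong immersions -/

/-- There is a strong immersion of `A` in `B` that preserves labels, and `A` and `B` have the same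
type. -/
def LGraph.Le {k : ℕ} {W : Type} (K : SimpleGraph W) (N : Set W) (A B : LGraph.{u} k) : Prop :=
  (∃ f : A.G ↪g B.G, ∀ x, B.lab (f x) = A.lab x) ∧ B.tp K N = A.tp K N

section Le

variable {k : ℕ} {W : Type} {K : SimpleGraph W} {N : Set W}

theorem LGraph.Le.trans {A B C : LGraph.{u} k} (h₁ : A.Le K N B) (h₂ : B.Le K N C) :
    A.Le K N C := by
  obtain ⟨⟨f, hf⟩, h₁⟩ := h₁
  obtain ⟨⟨g, hg⟩, h₂⟩ := h₂
  exact ⟨⟨f.trans g, fun x => (hg _).trans (hf x)⟩, h₂.trans h₁⟩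

theorem LGraph.Imm.map {A B : LGraph.{u} k} {X : Set W} {ℓ : W → Set (Fin k)} {g : W → A.V}
    (hg : A.Imm K X ℓ g) (f : A.G ↪g B.G) (hf : ∀ x, B.lab (f x) = A.lab x) :
    B.Imm K X ℓ (fun x => f (g x)) :=
  ⟨fun _ hx _ hy h => hg.1 hx hy (f.injective h),
    fun x hx y hy h => f.map_adj_iff.2 (hg.2.1 x hx y hy h),
    fun x hx => by rw [hf]; exact hg.2.2 x hx⟩

theorem tp_le_of_embedding {A B : LGraph.{u} k} (f : A.G ↪g B.G)
    (hf : ∀ x, B.lab (f x) = A.lab x) : A.tp K N ≤ B.tp K N := by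
  refine ⟨?_, ?_⟩
  · rintro p ⟨g, hg⟩
    exact ⟨_, hg.map f hf⟩
  · rintro p ⟨g, hg⟩
    refine ⟨fun i x => f (g i x), fun i => (hg.1 i).map f hf, fun i x hx => ?_, ?_⟩
    · simp only [hg.2.1 i hx]
    · intro i j hij x hx y hy h
      exact hg.2.2 i j hij x hx y hy (f.injective h)

theorem LGraph.Le.of_iso {A B : LGraph.{u} k} (f : A.G ≃g B.G)
    (hf : ∀ x, B.lab (f x) = A.lab x) : A.Le K N B := by
  refine ⟨⟨f.toEmbedding, hf⟩, le_antisymm ?_ (tp_le_of_embedding f.toEmbedding hf)⟩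
  refine tp_le_of_embedding f.symm.toEmbedding fun x => ?_
  have := hf (f.symm x)
  rw [f.apply_symm_apply] at this
  exact this.symm

/-- A one-vertex pattern with label `0` detects this. It ensures that a replaced summand is still
attached to the apex. -/
theorem exists_zero_mem_lab_of_tp_eq [Nonempty W] {A B : LGraph.{u} (k + 1)}
    (h : A.tp K N = B.tp K N) (hB : ∃ b, 0 ∈ B.lab b) : ∃ a, 0 ∈ A.lab a := by
  obtain ⟨w⟩ := ‹Nonempty W›
  obtain ⟨b, hb⟩ := hB
  have h1 : (({w}, fun _ => {0}) : Pattern W (k + 1)) ∈ (B.tp K N).1 := by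
    refine ⟨fun _ => b, Set.injOn_singleton _ _, ?_, ?_⟩
    · rintro x rfl y rfl hxy
      exact absurd hxy (K.irrefl)
    · rintro x _
      simpa using hb
  rw [← h] at h1
  obtain ⟨f, hf⟩ := h1
  exact ⟨f w, hf.2.2 w rfl rfl⟩

end Le

/-! ### Embeddings, connectedness and raylessness of cones -/

section ConeGraph

variable {k : ℕ} {I I' : Type u} {A : I → LGraph.{u} (k + 1)} {A' : I' → LGraph.{u} (k + 1)}
  {s : Set (Fin k)}

theorem exists_cone_embedding (e : I → I') (he : Function.Injective e)
    (h : ∀ i, ∃ f : (A i).G ↪g (A' (e i)).G, ∀ x, (A' (e i)).lab (f x) = (A i).lab x) :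
    ∃ f : (cone A s).G ↪g (cone A' s).G, ∀ x, (cone A' s).lab (f x) = (cone A s).lab x := by
  choose f hf using h
  let F : (cone A s).V → (cone A' s).V := fun x => match x with
    | none => none
    | some p => some ⟨e p.1, f p.1 p.2⟩
  have hF : Function.Injective F := by
    rintro (_ | ⟨i, a⟩) (_ | ⟨j, b⟩) h
    · rfl
    · cases h
    · cases h
    · obtain ⟨h1, h2⟩ := Sigma.mk.inj_iff.1 (Option.some.inj h)
      obtain rfl := he h1
      obtain rfl := (f i).injective (eq_of_heq h2)
      rfl
  refine ⟨⟨⟨F, hF⟩, ?_⟩, ?_⟩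
  · rintro (_ | ⟨i, a⟩) (_ | ⟨j, b⟩)
    · exact Iff.rfl
    · change 0 ∈ (A' (e j)).lab (f j b) ↔ 0 ∈ (A j).lab b
      rw [hf]
    · change 0 ∈ (A' (e i)).lab (f i a) ↔ 0 ∈ (A i).lab a
      rw [hf]
    · constructor
      · intro h
        obtain rfl : i = j := he (cone_adj_fst h)
        exact cone_adj_some.2 ((f i).map_adj_iff.1 (cone_adj_some.1 h))
      · intro h
        obtain rfl : i = j := cone_adj_fst h
        exact cone_adj_some.2 ((f i).map_adj_iff.2 (cone_adj_some.1 h))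
  · rintro (_ | ⟨i, a⟩)
    · rfl
    · change Fin.succ ⁻¹' (A' (e i)).lab (f i a) = _
      rw [hf]
      rfl

theorem exists_zero_mem_lab_of_cone_connected (h : (cone A s).G.Connected) (i : I) :
    ∃ a, 0 ∈ (A i).lab a := by
  obtain ⟨a₀⟩ := (A i).nonempty
  obtain ⟨p⟩ := h.preconnected (some ⟨i, a₀⟩) none
  have : ∀ {x y : (cone A s).V} (_ : (cone A s).G.Walk x y), y = none →
      (∃ a, x = some ⟨i, a⟩) → ∃ a, 0 ∈ (A i).lab a := by
    intro x y p
    induction p with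
    | nil => rintro rfl ⟨a, ha⟩; cases ha
    | @cons x z y hxz p ih =>
      rintro hy ⟨a, rfl⟩
      rcases z with _ | ⟨j, b⟩
      · exact ⟨a, hxz⟩
      · obtain rfl : i = j := cone_adj_fst hxz
        exact ih hy ⟨b, rfl⟩
  exact this p rfl ⟨a₀, rfl⟩

theorem cone_connected (hc : ∀ i, (A i).G.Connected) (h0 : ∀ i, ∃ a, 0 ∈ (A i).lab a) :
    (cone A s).G.Connected := by
  have key : ∀ x, (cone A s).G.Reachable x none := by
    rintro (_ | ⟨i, b⟩)
    · exact SimpleGraph.Reachable.refl _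
    · obtain ⟨a, ha⟩ := h0 i
      let g : (A i).G →g (cone A s).G := ⟨fun x => some ⟨i, x⟩, fun h => cone_adj_some.2 h⟩
      have h1 := ((hc i).preconnected b a).map g
      have h2 : (cone A s).G.Adj (some ⟨i, a⟩) none := ha
      exact h1.trans h2.reachable
  exact (SimpleGraph.connected_iff _).2
    ⟨fun x y => (key x).trans (key y).symm, ⟨none⟩⟩

/-- A ray visits the apex at most once, so a tail of it stays in one summand. -/
theorem cone_rayless (h : ∀ i, Rayless (A i).G) : Rayless (cone A s).G := by
  rintro ⟨x, hinj, hadj⟩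
  obtain ⟨m, hm⟩ : ∃ m, ∀ n, x (m + n) ≠ none := by
    by_cases hx : ∃ m, x m = none
    · obtain ⟨m, hm⟩ := hx
      refine ⟨m + 1, fun n hn => ?_⟩
      have := hinj (hn.trans hm.symm)
      omega
    · push Not at hx
      exact ⟨0, fun n => hx _⟩
  obtain ⟨⟨i, a₀⟩, h₀⟩ := Option.ne_none_iff_exists'.1 (hm 0)
  have key : ∀ n, ∃ a, x (m + n) = some ⟨i, a⟩ := by
    intro n
    induction n with
    | zero => exact ⟨a₀, h₀⟩
    | succ n ih =>
      obtain ⟨a, ha⟩ := ih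
      obtain ⟨⟨j, b⟩, hb⟩ := Option.ne_none_iff_exists'.1 (hm (n + 1))
      have hn := hadj (m + n)
      rw [ha] at hn
      have hb' : x (m + n + 1) = some ⟨j, b⟩ := hb
      rw [hb'] at hn
      obtain rfl : i = j := cone_adj_fst hn
      exact ⟨b, hb⟩
  choose a ha using key
  refine h i ⟨a, fun n n' e => ?_, fun n => ?_⟩
  · have e' : x (m + n) = x (m + n') := by rw [ha n, ha n', e]
    have := hinj e'
    omega
  · have h1 := hadj (m + n)
    have h2 : x (m + n + 1) = some ⟨i, a (n + 1)⟩ := ha (n + 1)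
    rw [ha n, h2] at h1
    exact cone_adj_some.1 h1

end ConeGraph

/-! ### Decomposing a connected graph at a vertex -/

section Decomposition

variable {V : Type u} (G : SimpleGraph V)

/-- The graph induced on `C`, where label `i` records the adjacency to the vertex `s i`. -/
def inducedLGraph {k : ℕ} (C : Set V) (hC : C.Nonempty) (s : Fin k → V) : LGraph.{u} k where
  V := C
  G := G.induce C
  lab x := {i | G.Adj (s i) x}
  nonempty := hC.to_subtype

/-- The vertex set of a component of `C - v`. -/
def compSet (C : Set V) (v : V) (i : (G.induce (C \ {v})).ConnectedComponent) : Set V :=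
  {x | ∃ h : x ∈ C \ {v}, (G.induce (C \ {v})).connectedComponentMk ⟨x, h⟩ = i}

variable {G}

theorem compSet_subset {C : Set V} {v : V} (i : (G.induce (C \ {v})).ConnectedComponent) :
    compSet G C v i ⊆ C \ {v} := fun _ hx => hx.1

theorem compSet_nonempty {C : Set V} {v : V} (i : (G.induce (C \ {v})).ConnectedComponent) :
    (compSet G C v i).Nonempty := by
  obtain ⟨⟨x, hx⟩, rfl⟩ := i.exists_rep
  exact ⟨x, hx, rfl⟩

theorem compSet_connected {C : Set V} {v : V} (i : (G.induce (C \ {v})).ConnectedComponent) :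
    (G.induce (compSet G C v i)).Connected := by
  let e : i.toSimpleGraph ≃g G.induce (compSet G C v i) :=
    { toFun := fun x => ⟨x.1.1, x.1.2, x.2⟩
      invFun := fun x => ⟨⟨x.1, x.2.choose⟩, x.2.choose_spec⟩
      left_inv := fun _ => rfl
      right_inv := fun _ => rfl
      map_rel_iff' := Iff.rfl }
  exact e.connected_iff.1 i.connected_toSimpleGraph

/-- The apex is `v`, and `Fin.cons v s` makes adjacency to `v` the new label `0`, so nothing is lost
by splitting into components. -/
theorem exists_iso_cone {k : ℕ} {C : Set V} {v : V} (hv : v ∈ C) (s : Fin k → V) :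
    ∃ f : (inducedLGraph G C ⟨v, hv⟩ s).G ≃g
      (cone (fun i => inducedLGraph G (compSet G C v i) (compSet_nonempty i) (Fin.cons v s))
        {i | G.Adj (s i) v}).G,
      ∀ x, (cone (fun i => inducedLGraph G (compSet G C v i) (compSet_nonempty i) (Fin.cons v s))
        {i | G.Adj (s i) v}).lab (f x) = (inducedLGraph G C ⟨v, hv⟩ s).lab x := by
  let A := fun i => inducedLGraph G (compSet G C v i) (compSet_nonempty i) (Fin.cons v s)
  let Ψ : Option (Σ i, compSet G C v i) → C := fun x => match x with
    | none => ⟨v, hv⟩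
    | some p => ⟨p.2.1, (compSet_subset p.1 p.2.2).1⟩
  have hinj : Function.Injective Ψ := by
    rintro (_ | ⟨i, x, hx⟩) (_ | ⟨j, y, hy⟩) h
    · rfl
    · exact absurd (congrArg Subtype.val h).symm (compSet_subset j hy).2
    · exact absurd (congrArg Subtype.val h) (compSet_subset i hx).2
    · obtain rfl : x = y := congrArg Subtype.val h
      obtain ⟨_, rfl⟩ := hx
      obtain ⟨_, rfl⟩ := hy
      rfl
  have hsurj : Function.Surjective Ψ := by
    rintro ⟨x, hx⟩
    by_cases h : x = v
    · exact ⟨none, Subtype.ext h.symm⟩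
    · exact ⟨some ⟨_, x, ⟨hx, h⟩, rfl⟩, rfl⟩
  have hadj : ∀ x y, G.Adj (Ψ x) (Ψ y) ↔ (cone A {i | G.Adj (s i) v}).G.Adj x y := by
    rintro (_ | ⟨i, x, hx⟩) (_ | ⟨j, y, hy⟩)
    · exact ⟨fun h => h.ne rfl, fun h => h.elim⟩
    · exact Iff.rfl
    · exact SimpleGraph.adj_comm _ _ _
    · constructor
      · intro h
        change G.Adj x y at h
        obtain ⟨hx', rfl⟩ := hx
        obtain ⟨hy', rfl⟩ := hy
        have hxy : (G.induce (C \ {v})).Adj ⟨x, hx'⟩ ⟨y, hy'⟩ := h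
        have e := SimpleGraph.ConnectedComponent.connectedComponentMk_eq_of_adj hxy
        refine ⟨_, ⟨x, hx', rfl⟩, ⟨y, hy', e.symm⟩, rfl, ?_, h⟩
        refine Sigma.ext e.symm ?_
        simp only
        congr 1
        · rw [e]
        · exact proof_irrel_heq _ _
      · rintro ⟨i, a, b, h1, h2, h⟩
        obtain ⟨rfl, h1⟩ := Sigma.mk.inj_iff.1 h1
        obtain ⟨rfl, h2⟩ := Sigma.mk.inj_iff.1 h2
        obtain rfl := eq_of_heq h1
        obtain rfl := eq_of_heq h2
        exact h
  let f : (cone A {i | G.Adj (s i) v}).G ≃g G.induce C :=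
    ⟨Equiv.ofBijective Ψ ⟨hinj, hsurj⟩, fun {x y} => hadj x y⟩
  refine ⟨f.symm, fun x => ?_⟩
  obtain ⟨y, rfl⟩ := f.surjective x
  change (cone A {i | G.Adj (s i) v}).lab (f.symm (f y)) = _
  rw [f.symm_apply_apply]
  rcases y with _ | ⟨i, y, hy⟩
  · rfl
  · rfl

end Decomposition


/-! ### Building universal families in stages -/

/-- For each number of labels, an indexed family of labelled graphs. -/
structure LFamily where
  /-- the index types -/
  J : ℕ → Type u
  /-- the graphs -/
  A : ∀ k, J k → LGraph.{u} k

/-- The union of a family of families of labelled graphs. -/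
def LFamily.union {ι : Type u} (S : ι → LFamily.{u}) : LFamily.{u} where
  J k := Σ i, (S i).J k
  A k p := (S p.1).A k p.2

/-- The index type of the summands of the cones in `LFamily.next`. -/
abbrev LFamily.Index (S : LFamily.{u}) {W : Type} (K : SimpleGraph W) (N : Set W) (Q : Type u)
    (k n : ℕ) (T : Set (Set (Pattern W k) × Set (Pattern W k))) : Type u :=
  ULift.{u} (Fin n) ⊕ {j : S.J k // (S.A k j).tp K N ∈ T ∧ (S.A k j).G.Connected} × Q

/-- The summands of the cones in `LFamily.next`. -/
def LFamily.summand (S : LFamily.{u}) {W : Type} (K : SimpleGraph W) (N : Set W) (Q : Type u)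
    {k n : ℕ} (l : Fin n → S.J k) (T : Set (Set (Pattern W k) × Set (Pattern W k))) :
    S.Index K N Q k n T → LGraph.{u} k
  | Sum.inl m => S.A k (l m.down)
  | Sum.inr p => S.A k p.1.1

/-- All cones over finitely many members of `S` together with `Q` copies of each connected member
whose type belongs to a given set of types. -/
def LFamily.next (S : LFamily.{u}) {W : Type} (K : SimpleGraph W) (N : Set W) (Q : Type u) :
    LFamily.{u} where
  J k := (Σ n : ℕ, Fin n → S.J (k + 1)) ×
    Set (Set (Pattern W (k + 1)) × Set (Pattern W (k + 1))) × Set (Fin k)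
  A _ p := cone (S.summand K N Q p.1.2 p.2.1) p.2.2

section Next

variable {W : Type} {K : SimpleGraph W} {N : Set W}

/-- Let `T` be the set of types occurring infinitely often. The finitely many summands with a type
outside `T` are listed individually; the rest embed in the `Q` copies supplied for types in `T`. The
embedding gives one inclusion of types, domination the other. -/
theorem LFamily.exists_next [Finite W] (hK : (K.induce Nᶜ).Connected) (S : LFamily.{u})
    {Q : Type u} {k : ℕ} {I : Type u} (hI : #I ≤ #Q) {D : I → LGraph.{u} (k + 1)}
    {s : Set (Fin k)} (hconn : (cone D s).G.Connected)
    (hD : ∀ i, ∃ j, (S.A (k + 1) j).G.Connected ∧ (D i).Le K N (S.A (k + 1) j)) :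
    ∃ j, ((S.next K N Q).A k j).G.Connected ∧ (cone D s).Le K N ((S.next K N Q).A k j) := by
  classical
  have : Nonempty W := ⟨hK.nonempty.some.1⟩
  choose j hj using hD
  obtain ⟨q⟩ : Nonempty (I ↪ Q) := hI
  let T : Set (Set (Pattern W (k + 1)) × Set (Pattern W (k + 1))) :=
    {t | Infinite {i // (D i).tp K N = t}}
  have hfin : {i | (D i).tp K N ∉ T}.Finite := by
    have : {i | (D i).tp K N ∉ T} = ⋃ t ∈ Tᶜ, {i | (D i).tp K N = t} := by ext; simp
    rw [this]
    refine (Set.toFinite _).biUnion fun t ht => ?_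
    exact Set.finite_coe_iff.1 (not_infinite_iff_finite.1 ht)
  have := hfin.to_subtype
  obtain ⟨n, ⟨e⟩⟩ := Finite.exists_equiv_fin {i | (D i).tp K N ∉ T}
  let l : Fin n → S.J (k + 1) := fun m => j (e.symm m)
  let A' := S.summand K N Q l T
  have htp : ∀ i, (S.A (k + 1) (j i)).tp K N = (D i).tp K N := fun i => (hj i).2.2
  -- Outside `T` the new cone has only the listed summands, so no such type becomes more frequent;
  -- inside `T` multiplicities are already infinite.
  have hdom : TypeDominated K N D A' := by
    intro t
    by_cases ht : t ∈ T
    · exact Or.inl ht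
    · right
      have key : ∀ i', (A' i').tp K N = t → ∃ m : Fin n, i' = Sum.inl ⟨m⟩ := by
        rintro (m | p) hp
        · exact ⟨m.down, rfl⟩
        · exact absurd (hp ▸ p.1.2.1) ht
      choose m hm using key
      refine ⟨fun x => ⟨e.symm (m x.1 x.2), ?_⟩, ?_⟩
      · rw [← htp]
        have h1 := x.2
        rw [hm x.1 x.2] at h1
        exact h1
      · rintro ⟨x, hx⟩ ⟨y, hy⟩ h
        have h1 : m x hx = m y hy :=
          e.symm.injective (Subtype.ext (congrArg (fun z => z.1) h))
        refine Subtype.ext ?_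
        simp only
        rw [hm x hx, hm y hy, h1]
  have hembed : ∃ f : (cone D s).G ↪g (cone A' s).G,
      ∀ x, (cone A' s).lab (f x) = (cone D s).lab x := by
    let ε : I → S.Index K N Q (k + 1) n T := fun i =>
      if h : (D i).tp K N ∈ T then Sum.inr (⟨j i, by rw [htp]; exact h, (hj i).1⟩, q i)
      else Sum.inl ⟨e ⟨i, h⟩⟩
    refine exists_cone_embedding ε ?_ ?_
    · intro x y hxy
      by_cases hx : (D x).tp K N ∈ T <;> by_cases hy : (D y).tp K N ∈ T
      · simp only [ε, dif_pos hx, dif_pos hy, Sum.inr.injEq, Prod.mk.injEq] at hxy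
        exact q.injective hxy.2
      · simp only [ε, dif_pos hx, dif_neg hy] at hxy
        cases hxy
      · simp only [ε, dif_pos hy, dif_neg hx] at hxy
        cases hxy
      · simp only [ε, dif_neg hx, dif_neg hy, Sum.inl.injEq, ULift.up.injEq] at hxy
        exact congrArg Subtype.val (e.injective hxy)
    · intro i
      have h1 : A' (ε i) = S.A (k + 1) (j i) := by
        by_cases h : (D i).tp K N ∈ T
        · simp only [ε, dif_pos h]
          rfl
        · simp only [ε, dif_neg h]
          change S.A (k + 1) (j (e.symm (e ⟨i, h⟩))) = _
          rw [e.symm_apply_apply]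
      rw [h1]
      exact (hj i).2.1
  refine ⟨⟨⟨n, l⟩, T, s⟩, ?_, hembed, ?_⟩
  · change (cone A' s).G.Connected
    refine cone_connected ?_ ?_
    · rintro (⟨m⟩ | p)
      · exact (hj _).1
      · exact p.1.2.2
    · intro i'
      -- Extra copies have a type that already occurs among the `D i`, whose attachment to the apex
      -- is known.
      have : ∃ i, (A' i').tp K N = (D i).tp K N := by
        rcases i' with ⟨m⟩ | p
        · exact ⟨_, htp _⟩
        · have : Infinite {i // (D i).tp K N = (S.A (k + 1) p.1.1).tp K N} := p.1.2.1
          obtain ⟨i, hi⟩ := (inferInstance :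
            Nonempty {i // (D i).tp K N = (S.A (k + 1) p.1.1).tp K N})
          exact ⟨i, hi.symm⟩
      obtain ⟨i, hi⟩ := this
      exact exists_zero_mem_lab_of_tp_eq hi (exists_zero_mem_lab_of_cone_connected hconn i)
  · obtain ⟨f, hf⟩ := hembed
    exact le_antisymm (Prod.le_def.2 ⟨tp_cone_fst_subset hdom, tp_cone_snd_subset hK hdom⟩)
      (tp_le_of_embedding f hf)

/-! ### Size of the families and their transfinite iteration -/

/-- The members of `S` are rayless and have at most `κ` vertices, and for each number of labels
there are at most `κ` of them. -/
structure LFamily.IsSmall (S : LFamily.{u}) (κ : Cardinal.{u}) : Prop where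
  card_index : ∀ k, #(S.J k) ≤ κ
  card_vertex : ∀ k j, #(S.A k j).V ≤ κ
  rayless : ∀ k j, Rayless (S.A k j).G

theorem LFamily.IsSmall.union {κ : Cardinal.{u}} (hκ : ℵ₀ ≤ κ) {ι : Type u} (hι : #ι ≤ κ)
    {S : ι → LFamily.{u}} (hS : ∀ i, (S i).IsSmall κ) : (LFamily.union S).IsSmall κ where
  card_index k := by
    change #(Σ i, (S i).J k) ≤ κ
    rw [Cardinal.mk_sigma]
    exact (Cardinal.sum_le_mk_mul_iSup _).trans
      (Cardinal.mul_le_of_le hκ hι (ciSup_le' fun i => (hS i).card_index k))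
  card_vertex k p := (hS p.1).card_vertex k p.2
  rayless k p := (hS p.1).rayless k p.2

/-- The index set stays small because a cone is given by a finite tuple and data from finite sets:
no arbitrary subfamily has to be chosen. -/
theorem LFamily.IsSmall.next [Finite W] {κ : Cardinal.{u}} (hκ : ℵ₀ ≤ κ) {Q : Type u}
    (hQ : #Q ≤ κ) {S : LFamily.{u}} (hS : S.IsSmall κ) : (S.next K N Q).IsSmall κ where
  card_index k := by
    have hfin : ∀ (X : Type) [Finite X], Cardinal.lift.{u} #X ≤ κ := fun X _ =>
      le_trans (by simp) hκ
    change #((Σ n : ℕ, Fin n → S.J (k + 1)) ×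
      Set (Set (Pattern W (k + 1)) × Set (Pattern W (k + 1))) × Set (Fin k)) ≤ κ
    rw [Cardinal.mk_prod, Cardinal.lift_uzero]
    refine Cardinal.mul_le_of_le hκ ?_ (hfin _)
    rw [← Cardinal.mk_congr List.equivSigmaTuple]
    exact (Cardinal.mk_list_le_max _).trans (max_le hκ (hS.card_index _))
  card_vertex k p := by
    change #(Option (Σ i, (S.summand K N Q p.1.2 p.2.1 i).V)) ≤ κ
    rw [Cardinal.mk_option]
    refine Cardinal.add_le_of_le hκ ?_ (Cardinal.one_le_aleph0.trans hκ)
    rw [Cardinal.mk_sigma]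
    refine (Cardinal.sum_le_mk_mul_iSup _).trans (Cardinal.mul_le_of_le hκ ?_ ?_)
    · rw [Cardinal.mk_sum, Cardinal.lift_id, Cardinal.lift_id]
      refine Cardinal.add_le_of_le hκ ?_ ?_
      · exact (Cardinal.mk_le_aleph0).trans hκ
      · rw [Cardinal.mk_prod, Cardinal.lift_id, Cardinal.lift_id]
        exact Cardinal.mul_le_of_le hκ
          ((Cardinal.mk_subtype_le _).trans (hS.card_index _)) hQ
    · refine ciSup_le' ?_
      rintro (m | q)
      · exact hS.card_vertex _ _
      · exact hS.card_vertex _ _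
  rayless k p := by
    refine cone_rayless ?_
    rintro (m | q)
    · exact hS.rayless _ _
    · exact hS.rayless _ _

/-- The transfinite iteration of `LFamily.next`. -/
noncomputable def stage (K : SimpleGraph W) (N : Set W) (Q : Type u) {O : Type u} [LT O]
    [WellFoundedLT O] : O → LFamily.{u} :=
  (wellFounded_lt (α := O)).fix fun w ih =>
    (LFamily.union fun β : {β : O // β < w} => ih β.1 β.2).next K N Q

theorem stage_eq {Q O : Type u} [LT O] [WellFoundedLT O] (w : O) :
    stage K N Q w =
      (LFamily.union fun β : {β : O // β < w} => stage K N Q β.1).next K N Q :=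
  (wellFounded_lt (α := O)).fix_eq _ w

theorem stage_isSmall [Finite W] {κ : Cardinal.{u}} (hκ : ℵ₀ ≤ κ) {Q : Type u}
    (hQ : #Q ≤ κ) {O : Type u} [LT O] [WellFoundedLT O]
    (hO : ∀ w : O, #{β : O // β < w} ≤ κ) (w : O) : (stage K N Q w).IsSmall κ := by
  induction w using (wellFounded_lt (α := O)).induction with
  | _ w ih =>
    rw [stage_eq]
    exact LFamily.IsSmall.next hκ hQ (LFamily.IsSmall.union hκ (hO w) fun β => ih β.1 β.2)

/-- Every connected induced subgraph of a rayless graph, labelled by the adjacency to finitely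
many vertices, has a type-preserving strong immersion in a connected member of some stage. -/
theorem exists_stage_le [Finite W] (hK : (K.induce Nᶜ).Connected) {κ : Cardinal.{u}}
    {Q O : Type u} (hQ : #Q = κ) [LT O] [WellFoundedLT O]
    (hO : ∀ (I : Type u) (w : I → O), #I ≤ κ → ∃ w', ∀ i, w i < w')
    {V : Type u} {G : SimpleGraph V} (hG : Rayless G) (hV : #V ≤ κ) :
    ∀ (p : Set V × V) (hp : p.2 ∈ p.1), (G.induce p.1).Connected → ∀ (k : ℕ) (s : Fin k → V),
      ∃ (w : O) (j : (stage K N Q w).J k), ((stage K N Q w).A k j).G.Connected ∧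
        (inducedLGraph G p.1 ⟨p.2, hp⟩ s).Le K N ((stage K N Q w).A k j) := by
  intro p
  induction p using hG.wellFounded.induction with
  | _ p ih =>
    obtain ⟨C, v⟩ := p
    intro hv hC k s
    simp only at hv hC
    let I := (G.induce (C \ {v})).ConnectedComponent
    let D : I → LGraph.{u} (k + 1) := fun i =>
      inducedLGraph G (compSet G C v i) (compSet_nonempty i) (Fin.cons v s)
    obtain ⟨f, hf⟩ := exists_iso_cone (G := G) hv s
    have hconn : (cone D {i | G.Adj (s i) v}).G.Connected := f.connected_iff.1 hC
    have hI : #I ≤ κ := by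
      refine le_trans ?_ ((Cardinal.mk_set_le (C \ {v})).trans hV)
      exact Cardinal.mk_le_of_surjective Quot.mk_surjective
    have hD : ∀ i, ∃ (w : O) (j : (stage K N Q w).J (k + 1)),
        ((stage K N Q w).A (k + 1) j).G.Connected ∧
          (D i).Le K N ((stage K N Q w).A (k + 1) j) := by
      intro i
      -- Choosing the next root `a` adjacent to `v` makes the recursion follow a path, as the
      -- well-founded relation demands.
      obtain ⟨a, ha⟩ := exists_zero_mem_lab_of_cone_connected hconn i
      exact ih (compSet G C v i, a.1) ⟨a.2, compSet_subset i, ha⟩ a.2 (compSet_connected i)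
        (k + 1) (Fin.cons v s)
    choose w j hj using hD
    obtain ⟨w', hw'⟩ := hO I w hI
    obtain ⟨j', hj', hle⟩ := LFamily.exists_next hK
      (LFamily.union fun β : {β : O // β < w'} => stage K N Q β.1) (Q := Q)
      (hI.trans hQ.ge) hconn
      (fun i => ⟨⟨⟨w i, hw' i⟩, j i⟩, (hj i).1, (hj i).2⟩)
    refine ⟨w', ?_⟩
    rw [stage_eq]
    exact ⟨j', hj', (LGraph.Le.of_iso f hf).trans hle⟩

end Next

/-! ### The upper bound -/

/-- With no labels left and stem `N`, the bouquet part of the type answers exactly whether the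
bouquet is contained. -/
theorem bouquet_isContained_iff {W : Type} {K : SimpleGraph W} {N : Set W} (A : LGraph.{u} 0)
    (ℓ : W → Set (Fin 0)) :
    (bouquet K N).IsContained A.G ↔ ∃ f, A.BImm K N N ℓ f := by
  classical
  constructor
  · rintro ⟨φ⟩
    let τ : ℕ → W → N ⊕ ℕ × (Nᶜ : Set W) := fun i x =>
      if h : x ∈ N then Sum.inl ⟨x, h⟩ else Sum.inr (i, ⟨x, h⟩)
    have τN : ∀ i x (h : x ∈ N), τ i x = Sum.inl ⟨x, h⟩ := fun i x h => dif_pos h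
    have τC : ∀ i x (h : x ∈ Nᶜ), τ i x = Sum.inr (i, ⟨x, h⟩) := fun i x h => dif_neg h
    refine ⟨fun i x => φ (τ i x), fun i => ⟨?_, ?_, fun x _ a => a.elim0⟩, fun i x hx => ?_, ?_⟩
    · intro x _ y _ h
      have h := φ.injective h
      by_cases hx : x ∈ N <;> by_cases hy : y ∈ N
      · rw [τN i x hx, τN i y hy] at h
        exact congrArg Subtype.val (Sum.inl.inj h)
      · rw [τN i x hx, τC i y hy] at h; cases h
      · rw [τC i x hx, τN i y hy] at h; cases h
      · rw [τC i x hx, τC i y hy] at h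
        exact congrArg (fun z => z.2.1) (Sum.inr.inj h)
    · intro x _ y _ h
      refine φ.toHom.map_adj ?_
      by_cases hx : x ∈ N <;> by_cases hy : y ∈ N
      · rw [τN i x hx, τN i y hy]; exact h
      · rw [τN i x hx, τC i y hy]; exact h
      · rw [τC i x hx, τN i y hy]; exact h
      · rw [τC i x hx, τC i y hy]; exact ⟨rfl, h⟩
    · simp only [τN _ x hx]
    · intro i j hij x hx y hy h
      have h := φ.injective h
      rw [τC i x hx, τC j y hy] at h
      exact hij (congrArg (fun z => z.1) (Sum.inr.inj h))
  · rintro ⟨f, hf, hM, hd⟩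
    let φ : N ⊕ ℕ × (Nᶜ : Set W) → A.V := Sum.elim (fun a => f 0 a) (fun p => f p.1 p.2)
    have mem : ∀ x : W, x ∈ N ∪ Nᶜ := fun x => by simp
    refine ⟨⟨⟨φ, ?_⟩, ?_⟩⟩
    · rintro (a | ⟨i, c⟩) (b | ⟨j, d⟩) h
      · exact (hf 0).2.1 a (mem _) b (mem _) h
      · change A.G.Adj (f 0 a) (f j d)
        rw [← hM j a.2]
        exact (hf j).2.1 a (mem _) d (mem _) h
      · change A.G.Adj (f i c) (f 0 b)
        rw [← hM i b.2]
        exact (hf i).2.1 c (mem _) b (mem _) h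
      · obtain ⟨rfl, h⟩ := h
        exact (hf i).2.1 c (mem _) d (mem _) h
    · rintro (a | ⟨i, c⟩) (b | ⟨j, d⟩) h
      · exact congrArg _ (Subtype.ext ((hf 0).1 (mem _) (mem _) h))
      · change f 0 a = f j d at h
        rw [← hM j a.2] at h
        have e := (hf j).1 (mem _) (mem _) h
        exact absurd (e ▸ a.2) d.2
      · change f i c = f 0 b at h
        rw [← hM i b.2] at h
        have e := (hf i).1 (mem _) (mem _) h
        exact absurd (e ▸ b.2) c.2
      · change f i c = f j d at h
        by_cases hij : i = j
        · subst hij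
          have e := (hf i).1 (mem _) (mem _) h
          rw [Subtype.ext e]
        · exact absurd h (hd i j hij c c.2 d d.2)

theorem exists_isStronglyUniversal_raylessFree {κ : Cardinal.{u}} (hκ : ℵ₀ ≤ κ) {W : Type}
    [Finite W] {K : SimpleGraph W} {N : Set W} (hK : (K.induce Nᶜ).Connected) :
    ∃ F : Set GraphObj.{u}, IsStronglyUniversal (raylessFree κ (bouquet K N)) F ∧
      #F ≤ Cardinal.lift.{u + 1} (Order.succ κ) := by
  let O := (Order.succ κ).ord.ToType
  have hOκ : #O = Order.succ κ := Cardinal.mk_ord_toType _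
  have hlt : ∀ w : O, #{β : O // β < w} ≤ κ := fun w =>
    Order.lt_succ_iff.1 ((Cardinal.mk_Iio_lt w (by simp [O])).trans_eq hOκ)
  -- Regularity of `κ⁺`: an unbounded family of this size would cover `O` by at most `κ` initial
  -- segments of size at most `κ`.
  have hbdd : ∀ (I : Type u) (w : I → O), #I ≤ κ → ∃ w', ∀ i, w i < w' := by
    intro I w hI
    by_contra hcon
    push Not at hcon
    choose i hi using hcon
    have h1 : #O ≤ #(Σ i, {β : O // β ≤ w i}) :=
      Cardinal.mk_le_of_injective (f := fun β => ⟨i β, β, hi β⟩) fun x y h => by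
        have : ((⟨i x, x, hi x⟩ : Σ i, {β : O // β ≤ w i}).2 : O) =
            ((⟨i y, y, hi y⟩ : Σ i, {β : O // β ≤ w i}).2 : O) := by
          simp only at h
          rw [h]
        exact this
    have h2 : #(Σ i, {β : O // β ≤ w i}) ≤ κ := by
      rw [Cardinal.mk_sigma]
      refine (Cardinal.sum_le_mk_mul_iSup _).trans
        (Cardinal.mul_le_of_le hκ hI (ciSup_le' fun i => ?_))
      have : {β : O | β ≤ w i} = insert (w i) {β | β < w i} := by
        ext β
        simp [le_iff_eq_or_lt]
      change #{β : O | β ≤ w i} ≤ κ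
      rw [this]
      exact Cardinal.mk_insert_le.trans
        (Cardinal.add_le_of_le hκ (hlt _) (Cardinal.one_le_aleph0.trans hκ))
    exact absurd (h1.trans h2) (by rw [hOκ, not_le]; exact Order.lt_succ κ)
  let Q := κ.out
  have hQ : #Q = κ := Cardinal.mk_out κ
  have hsmall : ∀ w : O, (stage K N Q w).IsSmall κ :=
    stage_isSmall hκ hQ.le hlt
  let Φ : (Σ w : O, (stage K N Q w).J 0) → GraphObj.{u} := fun p =>
    ⟨_, ((stage K N Q p.1).A 0 p.2).G⟩
  -- Stages may also contain disconnected graphs or graphs that contain the bouquet; these are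
  -- discarded.
  refine ⟨Set.range Φ ∩ raylessFree κ (bouquet K N), ⟨Set.inter_subset_right, ?_⟩, ?_⟩
  · rintro ⟨V, G⟩ ⟨hconn, hray, hcard, hfree⟩
    simp only at hconn hray hcard hfree
    obtain ⟨v⟩ := hconn.nonempty
    let ι : G.induce Set.univ ≃g G := SimpleGraph.induceUnivIso G
    obtain ⟨w, j, hc, ⟨f, _⟩, htp⟩ := exists_stage_le hK hQ hbdd hray hcard
      (Set.univ, v) (Set.mem_univ v) (ι.connected_iff.2 hconn) 0 Fin.elim0
    refine ⟨Φ ⟨w, j⟩, ⟨⟨_, rfl⟩, hc, (hsmall w).rayless _ _, (hsmall w).card_vertex _ _, ?_⟩,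
      ⟨ι.symm.toEmbedding.trans f⟩⟩
    intro hB
    have h1 := (bouquet_isContained_iff ((stage K N Q w).A 0 j) fun _ => ∅).1 hB
    have h2 : ((N, fun _ => ∅) : Pattern W 0) ∈ (((stage K N Q w).A 0 j).tp K N).2 := h1
    rw [htp] at h2
    obtain ⟨φ⟩ := (bouquet_isContained_iff _ _).2 h2
    exact hfree ⟨ι.toEmbedding.toCopy.comp φ⟩
  · refine (Cardinal.mk_le_mk_of_subset Set.inter_subset_left).trans ?_
    have h1 := Cardinal.mk_range_le_lift (f := Φ)
    rw [Cardinal.lift_id'.{u, u + 1}] at h1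
    refine h1.trans (Cardinal.lift_le.2 ?_)
    have hκ' : ℵ₀ ≤ Order.succ κ := hκ.trans (Order.le_succ κ)
    rw [Cardinal.mk_sigma]
    exact (Cardinal.sum_le_mk_mul_iSup _).trans (Cardinal.mul_le_of_le hκ' hOκ.le
      (ciSup_le' fun w => ((hsmall w).card_index 0).trans (Order.le_succ κ)))

/-- A bouquet depends on the graph and the stem only up to isomorphism. -/
theorem exists_bouquet_iso {W : Type v} {W' : Type*} (K : SimpleGraph W) (N : Set W)
    (e : W' ≃ W) : Nonempty (bouquet K N ≃g bouquet (K.comap e) (e ⁻¹' N)) := by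
  let e₁ : N ≃ (e ⁻¹' N : Set W') := e.symm.subtypeEquiv fun a => by simp
  let e₂ : (Nᶜ : Set W) ≃ ((e ⁻¹' N)ᶜ : Set W') := e.symm.subtypeEquiv fun a => by simp
  refine ⟨⟨Equiv.sumCongr e₁ ((Equiv.refl ℕ).prodCongr e₂), ?_⟩⟩
  have h : ∀ a b, (K.comap e).Adj (e.symm a) (e.symm b) ↔ K.Adj a b := by simp
  rintro (a | ⟨i, c⟩) (b | ⟨j, d⟩)
  · exact h a b
  · exact h a d
  · exact h c b
  · exact and_congr Iff.rfl (h c d)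

end RaylessUniversality

/-! ### The main theorem -/

theorem mainTheorem5 (κ : Cardinal.{u}) (hκ : Cardinal.aleph0 ≤ κ)
    {W : Type v} [Finite W] (K : SimpleGraph W) (N : Set W)
    (hK : (K.induce Nᶜ).Connected)
    (hB : ∃ D : (RaylessUniversality.bouquet K N).ConnectedComponent,
      ¬ RaylessUniversality.IsSubdivisionOfStar D.toSimpleGraph) :
    RaylessUniversality.stc
        (RaylessUniversality.raylessFree κ (RaylessUniversality.bouquet K N)) =
      Cardinal.lift.{u + 1} (Order.succ κ) := by
  open RaylessUniversality in
  obtain ⟨d, hd⟩ := bouquet_exists_short_walk K N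
  -- Replacing `W` by `Fin n` brings patterns and types into the lowest universe, as the upper bound
  -- requires; the class is unchanged.
  obtain ⟨n, ⟨e⟩⟩ := Finite.exists_equiv_fin W
  obtain ⟨ε⟩ := exists_bouquet_iso K N e.symm
  have hK' : ((K.comap e.symm).induce (e.symm ⁻¹' N)ᶜ).Connected := by
    let i : K.induce Nᶜ ≃g (K.comap e.symm).induce (e.symm ⁻¹' N)ᶜ :=
      ⟨e.subtypeEquiv fun a => by simp, by simp⟩
    exact i.connected_iff.1 hK
  have hclass : raylessFree κ (bouquet K N) =
      raylessFree.{u} κ (bouquet (K.comap e.symm) (e.symm ⁻¹' N)) := by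
    ext G
    simp only [raylessFree, Set.mem_ofPred_eq]
    rw [SimpleGraph.free_congr ε SimpleGraph.Iso.refl]
  obtain ⟨F, hF, hcard⟩ := exists_isStronglyUniversal_raylessFree hκ hK'
  rw [← hclass] at hF
  apply le_antisymm
  · refine le_trans (csInf_le' ?_) hcard
    exact ⟨F, hF, rfl⟩
  · refine le_csInf ⟨_, F, hF, rfl⟩ ?_
    rintro _ ⟨F', hF', rfl⟩
    exact lift_succ_le_mk_of_isStronglyUniversal hκ hd hB hF'
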